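/- **Setting.** Fix a first-order signature. Clauses $\Gamma\to\Delta$ are pairs of finite multisets of atoms (negative literals $\Gamma$, positive literals $\Delta$), where atoms are $P(t)$ with $P$ monadic, or equations. Variables have depth $0$, and a constant or $f(t_1,\dots,t_n)$ has depth $1$ plus the maximal depth of its arguments (so constants have depth $1$); a term is *complex* if it is not a variable, *shallow* if its depth is at most $1$, *linear* if no variable occurs twice in it. A clause is *MSL* if all atoms of $\Delta$ are of the form $P(s)$ with $s$ shallow and linear, the atoms of $\Delta$ are pairwise variable disjoint, and either $\Gamma$ contains no equation, or $\Gamma=\{s\approx t\}$ and $\Delta=\emptyset$ with $s,t$ not unifiable. A term is *straight* if it is a variable, a constant, or $f(s_1,\dots,s_n)$ where the $s_i$ are different variables except for at most one, which is a straight term (not containing the other $s_j$). A *straight dismatching constraint* $\pi$ is $\bot$ or a finite conjunction $\bigwedge_i t_i\neq s_i$ with $s_i$ straight; the variables of the $s_i$ are local, substitutions act on the $t_i$ only, and conjunctions are compared as sets, modulo renaming the variables of the $s_i$. Its depth is the maximal depth of the $s_i$. A *solution* of $\pi$ is a grounding substitution $\delta$ such that no $t_i\delta$ is an instance of $s_i$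 ($\bot$ has none). A normal form $\pi{\downarrow}$ is obtained by exhaustively applying the rules: $\pi\wedge f(\vec t)\neq y\Rightarrow\bot$; $\pi\wedge f(\vec t)\neq f(y_1,\dots,y_n)\Rightarrow\bot$ for variables $y_i$; $\pi\wedge f(\vec t)\neq f(\vec s)\Rightarrow\pi\wedge t_i\neq s_i$ if $s_i$ is complex; $\pi\wedge f(\vec t)\neq g(\vec s)\Rightarrow\pi$ if $f\ne g$; $\pi\wedge x\neq s\wedge x\neq s\tau\Rightarrow\pi\wedge x\neq s$. An *MSL(SDC) clause* is a pair $(C;\pi)$ of an MSL clause and a straight dismatching constraint. Its ground clauses are the $C\delta$ with $\delta$ a solution of $\pi$; two constrained clauses are *variants* if they have the same ground clauses. $(C';\pi')$ is a *condensation* of $(C;\pi)$ if $C'\subsetneq C$, $\pi'\subseteq\pi$, and for some substitution $\sigma$, $\pi\sigma=\pi'$ and $L\sigma\in C'$ for all literals $L\in C$. Let $\prec$ be an irreflexive, total, well-founded ordering on ground atoms, extended to literals by representing $A$ and $\neg A$ by the multisets $\{A\}$ and $\{A,A\}$, and to clauses by the multiset extension of the literal ordering, such that $\neg Q(s)$ is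 never greater than $P(t)$ when $s$ is a proper subterm of $t$. A literal is [strictly] maximal in a constrained clause $(C;\pi)$ if for some solution $\delta$ of $\pi$ its $\delta$-instance is $\succeq$ [$\succ$] the $\delta$-instances of all other literals of $C$. In $S_1(t_1),\dots,S_n(t_n)\to P_1(s_1),\dots,P_m(s_m)$ the selection function $\mathrm{sel}$ selects $S_i(t_i)$ iff (1) $t_i$ is not a variable, or (2) all $t_j$ are variables and $t_i\notin\mathrm{vars}(s_1,\dots,s_m)$, or (3) $\{t_1,\dots,t_n\}\subseteq\mathrm{vars}(s_1,\dots,s_m)$ and $t_i=s_j$ for some $j$; in $s\approx t\to$ it selects the equation. *SDC-resolution* derives $((\Gamma_1,\Gamma_2\to\Delta_1,\Delta_2)\sigma;\ ((\pi_1\wedge\pi_2)\sigma){\downarrow})$ from variable-disjoint copies of $(\Gamma_1\to\Delta_1,A;\pi_1)$ and $(\Gamma_2,B\to\Delta_2;\pi_2)$ if $\sigma=\mathrm{mgu}(A,B)$, the new constraint is solvable, $A\sigma$ is strictly maximal in $(\Gamma_1\to\Delta_1,A;\pi_1)\sigma$ and nothing is selected in $\Gamma_1\to\Delta_1,A$,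 and either $B$ is selected in $\Gamma_2,B\to\Delta_2$, or nothing is selected there and $\neg B\sigma$ is maximal in $(\Gamma_2,B\to\Delta_2;\pi_2)\sigma$. *SDC-factoring* derives $((\Gamma\to\Delta,A)\sigma;(\pi\sigma){\downarrow})$ from $(\Gamma\to\Delta,A,B;\pi)$ if $\sigma=\mathrm{mgu}(A,B)$, nothing is selected in the premise, $A\sigma$ is maximal in $(\Gamma\to\Delta,A,B;\pi)\sigma$ and the new constraint is solvable. A constrained clause is *redundant* in $N$ if each of its ground clauses $D$ is entailed (with respect to Herbrand interpretations, i.e. sets of ground atoms) by finitely many ground clauses of $N$ that are $\prec D$. $N$ is *saturated up to redundancy* if the result of every inference between clauses in $N$ is redundant in $N$ or has all its ground clauses among those of $N$. **Theorem.** (a) For every finite set $N$ of MSL(SDC) clauses there is a finite set $N'$ of MSL(SDC) clauses that is saturated up to redundancy and is obtained from $N$ by finitely many steps, each of which adds the result of an SDC-resolution or SDC-factoring inference between clauses already present, possibly after condensing this result finitely often. (b) Suppose the signature is finite, and let $N$ be a set of MSL(SDC) clauses with constraints in normal form, no element of which has a condensation and no two different elements of which are variants. Then $N$ is finite if there is an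 integer $d$ such that every $(C;\pi)\in N$ satisfies $\mathrm{depth}(\pi)\le d$ and $C$ has the form $S_1(x_1),\dots,S_n(x_n),S'_1(t),\dots,S'_m(t)\to\Delta$ or $S_1(x_1),\dots,S_n(x_n),S'_1(t),\dots,S'_m(t)\to S(t),\Delta$ with variables $x_i$ and $t$ shallow, linear and sharing no variable with $\Delta$. -/

import Mathlib

universe u v

namespace MSLSDC

/-! ### Terms

Signatures are Mathlib's first-order languages, terms are Mathlib's terms, the substitution `σ`
acts by `FirstOrder.Language.Term.subst`. Non-ground objects use the variables `ℕ`; ground objects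
are the ones over the empty type of variables. -/

section Terms

variable {L : FirstOrder.Language.{u, v}} {α : Type*}

/-- The multiset of variable occurrences of a term. -/
def termVars : L.Term α → Multiset α
  | .var x => {x}
  | .func _ ts => ∑ i, termVars (ts i)

/-- Variables have depth zero, constants have depth one (they are complex terms). -/
def termDepth : L.Term α → ℕ
  | .var _ => 0
  | .func _ ts => 1 + Finset.univ.sup fun i => termDepth (ts i)

/-- A term is complex if it is not a variable. -/
def IsComplex (t : L.Term α) : Prop := ∀ x, t ≠ .var x

/-- A term is shallow if it has depth at most one: a variable, a constant, or a function symbol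
applied to variables. -/
def IsShallow (t : L.Term α) : Prop := termDepth t ≤ 1

/-- A term is linear if no variable occurs twice in it. -/
def IsLinearTerm (t : L.Term α) : Prop := (termVars t).Nodup

/-- `ProperSubterm s t`: the term `s` is the subterm of `t` at some non-root position. -/
inductive ProperSubterm : L.Term α → L.Term α → Prop
  | arg {n : ℕ} (f : L.Functions n) (ts : Fin n → L.Term α) (i : Fin n) :
      ProperSubterm (ts i) (.func f ts)
  | deep {n : ℕ} (f : L.Functions n) (ts : Fin n → L.Term α) (i : Fin n) (s : L.Term α) :
      ProperSubterm s (ts i) → ProperSubterm s (.func f ts)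

/-- Straight terms: variables, constants, and terms `f(s₁, …, sₙ)` whose arguments are different
variables except for at most one argument, which is a straight term (not containing the
other arguments). -/
inductive IsStraight : L.Term α → Prop
  | var (x : α) : IsStraight (.var x)
  | flat {n : ℕ} (f : L.Functions n) (y : Fin n → α) (hy : Function.Injective y) :
      IsStraight (.func f fun i => .var (y i))
  | nest {n : ℕ} (f : L.Functions n) (ss : Fin n → L.Term α) (i : Fin n) (y : Fin n → α)
      (hs : IsStraight (ss i)) (hvar : ∀ j, j ≠ i → ss j = .var (y j))
      (hinj : ∀ j k, j ≠ i → k ≠ i → y j = y k → j = k)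
      (hnot : ∀ j, j ≠ i → y j ∉ termVars (ss i)) :
      IsStraight (.func f ss)

/-- Two terms that differ only by renaming their variables. -/
def RenamingEquiv (s t : L.Term α) : Prop :=
  (∃ ρ : α → α, s.relabel ρ = t) ∧ ∃ ρ : α → α, t.relabel ρ = s

end Terms

/-! ### Atoms, literals, clauses -/

/-- Atoms: a monadic predicate applied to a term, or an equation. -/
inductive Atom (L : FirstOrder.Language.{u, v}) (α : Type) : Type (max u v)
  | pred (P : L.Relations 1) (t : L.Term α) : Atom L α
  | eqn (s t : L.Term α) : Atom L α

inductive Literal (L : FirstOrder.Language.{u, v}) (α : Type) : Type (max u v)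
  | pos (A : Atom L α) : Literal L α
  | neg (A : Atom L α) : Literal L α

/-- The clause `ante → succ`. -/
@[ext]
structure Clause (L : FirstOrder.Language.{u, v}) (α : Type) : Type (max u v) where
  ante : Multiset (Atom L α)
  succ : Multiset (Atom L α)

section Clauses

variable {L : FirstOrder.Language.{u, v}} {α β : Type}

def Atom.subst (σ : α → L.Term β) : Atom L α → Atom L β
  | .pred P t => .pred P (t.subst σ)
  | .eqn s t => .eqn (s.subst σ) (t.subst σ)

/-- The multiset of variable occurrences of an atom. -/
def Atom.vars : Atom L α → Multiset α
  | .pred _ t => termVars t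
  | .eqn s t => termVars s + termVars t

def Atom.IsEqn (A : Atom L α) : Prop := ∃ s t, A = .eqn s t

def Literal.subst (σ : α → L.Term β) : Literal L α → Literal L β
  | .pos A => .pos (A.subst σ)
  | .neg A => .neg (A.subst σ)

def Clause.subst (σ : α → L.Term β) (C : Clause L α) : Clause L β :=
  ⟨C.ante.map (Atom.subst σ), C.succ.map (Atom.subst σ)⟩

def Clause.literals (C : Clause L α) : Multiset (Literal L α) :=
  C.ante.map .neg + C.succ.map .pos

/-- Multiset of the variable occurrences in the succedent. -/
def Clause.succVars (C : Clause L α) : Multiset α := C.succ.bind Atom.vars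

/-- Proper inclusion of clauses as multisets of literals. -/
def Clause.ProperSub (C' C : Clause L α) : Prop :=
  C'.ante ≤ C.ante ∧ C'.succ ≤ C.succ ∧ C' ≠ C

/-- MSL clauses. All predicates are monadic by the definition of atoms. -/
structure IsMSL (C : Clause L ℕ) : Prop where
  /-- every positive literal is a non-equational atom whose argument is shallow -/
  shallow : ∀ A ∈ C.succ, ∃ P t, A = .pred P t ∧ IsShallow t
  /-- the atoms of the succedent are linear and pairwise variable disjoint -/
  linear : C.succVars.Nodup
  /-- no negative equations, or the clause is a single disequation of non-unifiable terms -/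
  neg_eqn : (∀ A ∈ C.ante, ¬ A.IsEqn) ∨
    ∃ s t, C.ante = {.eqn s t} ∧ C.succ = 0 ∧ ∀ σ : ℕ → L.Term ℕ, s.subst σ ≠ t.subst σ

/-- `Selected C A`: the negative literal with atom `A` is selected in `C`. -/
def Selected (C : Clause L ℕ) (A : Atom L ℕ) : Prop :=
  A ∈ C.ante ∧
    (A.IsEqn ∨ ∃ S t, A = .pred S t ∧
      (IsComplex t ∨
        ((∀ B ∈ C.ante, ∃ S' x, B = .pred S' (.var x)) ∧ ∃ x, t = .var x ∧ x ∉ C.succVars) ∨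
        ((∀ B ∈ C.ante, ∃ S' x, B = .pred S' (.var x) ∧ x ∈ C.succVars) ∧
          ∃ P, Atom.pred P t ∈ C.succ)))

def NoneSelected (C : Clause L ℕ) : Prop := ∀ A, ¬ Selected C A

end Clauses

/-! ### Dismatching constraints -/

/-- An atomic constraint `lhs ≠ rhs`. The variables of `rhs` are local to the atomic constraint
(they are bound in its meaning), hence are different from those of `lhs` and untouched by
substitutions. -/
structure Diseq (L : FirstOrder.Language.{u, v}) (α : Type) : Type (max u v) where
  lhs : L.Term α
  rhs : L.Term ℕ

/-- Conjunctions of atomic constraints (the empty conjunction being `⊤`), and `⊥`. -/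
inductive Constraint (L : FirstOrder.Language.{u, v}) (α : Type) : Type (max u v)
  | bot : Constraint L α
  | conj (m : Multiset (Diseq L α)) : Constraint L α

section Constraints

variable {L : FirstOrder.Language.{u, v}} {α β : Type}

def Diseq.subst (σ : α → L.Term β) (d : Diseq L α) : Diseq L β := ⟨d.lhs.subst σ, d.rhs⟩

/-- Equality of atomic constraints modulo renaming of the local variables. -/
def Diseq.Equiv (d e : Diseq L α) : Prop := d.lhs = e.lhs ∧ RenamingEquiv d.rhs e.rhs

namespace Constraint

def subst (σ : α → L.Term β) : Constraint L α → Constraint L β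
  | bot => bot
  | conj m => conj (m.map (Diseq.subst σ))

/-- Conjunction of two constraints. -/
def and : Constraint L α → Constraint L α → Constraint L α
  | conj m, conj n => conj (m + n)
  | _, _ => bot

/-- All right-hand sides are straight. -/
def IsStraightConstraint : Constraint L α → Prop
  | bot => True
  | conj m => ∀ d ∈ m, IsStraight d.rhs

/-- Maximal depth of the right-hand sides. -/
def depth : Constraint L α → ℕ
  | bot => 0
  | conj m => (m.map fun d => termDepth d.rhs).sup

/-- Inclusion of constraints as sets of atomic constraints. -/
def Sub : Constraint L α → Constraint L α → Prop
  | bot, bot => True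
  | conj m, conj n => m ⊆ n
  | _, _ => False

/-- Equality of constraints as sets of atomic constraints modulo renaming of local variables. -/
def Same : Constraint L α → Constraint L α → Prop
  | bot, bot => True
  | conj m, conj n => (∀ d ∈ m, ∃ e ∈ n, d.Equiv e) ∧ ∀ e ∈ n, ∃ d ∈ m, d.Equiv e
  | _, _ => False

/-- The grounding substitution `δ` is a solution: no left-hand side is mapped to an instance of its
right-hand side. -/
def IsSolution (δ : α → L.Term Empty) : Constraint L α → Prop
  | bot => False
  | conj m => ∀ d ∈ m, ¬ ∃ τ : ℕ → L.Term Empty, d.lhs.subst δ = d.rhs.subst τ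

def Solvable (π : Constraint L α) : Prop := ∃ δ, π.IsSolution δ

/-- The rewriting rules of constraint normalization. -/
inductive NormStep : Constraint L α → Constraint L α → Prop
  | clashVar {n : ℕ} (m : Multiset (Diseq L α)) (f : L.Functions n) (ts : Fin n → L.Term α)
      (y : ℕ) :
      NormStep (conj (⟨.func f ts, .var y⟩ ::ₘ m)) bot
  | clashFlat {n : ℕ} (m : Multiset (Diseq L α)) (f : L.Functions n) (ts : Fin n → L.Term α)
      (y : Fin n → ℕ) :
      NormStep (conj (⟨.func f ts, .func f fun i => .var (y i)⟩ ::ₘ m)) bot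
  | descend {n : ℕ} (m : Multiset (Diseq L α)) (f : L.Functions n) (ts : Fin n → L.Term α)
      (ss : Fin n → L.Term ℕ) (i : Fin n) (hi : IsComplex (ss i)) :
      NormStep (conj (⟨.func f ts, .func f ss⟩ ::ₘ m)) (conj (⟨ts i, ss i⟩ ::ₘ m))
  | differ {n k : ℕ} (m : Multiset (Diseq L α)) (f : L.Functions n) (ts : Fin n → L.Term α)
      (g : L.Functions k) (ss : Fin k → L.Term ℕ)
      (hfg : (⟨n, f⟩ : Σ l, L.Functions l) ≠ ⟨k, g⟩) :
      NormStep (conj (⟨.func f ts, .func g ss⟩ ::ₘ m)) (conj m)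
  | subsume (m : Multiset (Diseq L α)) (x : α) (s : L.Term ℕ) (τ : ℕ → L.Term ℕ) :
      NormStep (conj (⟨.var x, s⟩ ::ₘ ⟨.var x, s.subst τ⟩ ::ₘ m)) (conj (⟨.var x, s⟩ ::ₘ m))

def IsNormal (π : Constraint L α) : Prop := ∀ π', ¬ NormStep π π'

/-- `π'` is a normal form of `π`. -/
def NormalFormOf (π π' : Constraint L α) : Prop :=
  Relation.ReflTransGen NormStep π π' ∧ π'.IsNormal

end Constraint

end Constraints

/-! ### Constrained clauses -/

/-- The constrained clause `(cl; con)`. -/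
structure CClause (L : FirstOrder.Language.{u, v}) : Type (max u v) where
  cl : Clause L ℕ
  con : Constraint L ℕ

section Ground

variable {L : FirstOrder.Language.{u, v}}

/-- MSL(SDC) clauses. -/
def IsMSLSDC (c : CClause L) : Prop := IsMSL c.cl ∧ c.con.IsStraightConstraint

/-- The ground clauses of a constrained clause. -/
def ground (c : CClause L) : Set (Clause L Empty) :=
  {D | ∃ δ : ℕ → L.Term Empty, c.con.IsSolution δ ∧ D = c.cl.subst δ}

/-- The ground clauses of a set of constrained clauses. -/
def groundSet (N : Set (CClause L)) : Set (Clause L Empty) := {D | ∃ c ∈ N, D ∈ ground c}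

/-- Variants have the same ground clauses. -/
def Variants (c c' : CClause L) : Prop := ground c = ground c'

/-- `c'` is a condensation of `c`. -/
def IsCondensationOf (c' c : CClause L) : Prop :=
  c'.cl.ProperSub c.cl ∧ c'.con.Sub c.con ∧
    ∃ σ : ℕ → L.Term ℕ, (c.con.subst σ).Same c'.con ∧
      ∀ l ∈ c.cl.literals, l.subst σ ∈ c'.cl.literals

/-- Satisfaction of a ground clause by a Herbrand interpretation. -/
def SatisfiedBy (I : Set (Atom L Empty)) (D : Clause L Empty) : Prop :=
  (∃ A ∈ D.succ, A ∈ I) ∨ ∃ A ∈ D.ante, A ∉ I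

/-- Entailment between ground clauses. -/
def Entails (M : Set (Clause L Empty)) (D : Clause L Empty) : Prop :=
  ∀ I : Set (Atom L Empty), (∀ E ∈ M, SatisfiedBy I E) → SatisfiedBy I D

end Ground

/-! ### Orderings -/

/-- The multiset extension of an ordering. -/
def MultisetExt {α : Type*} (r : α → α → Prop) (M N : Multiset α) : Prop :=
  ∃ X Y Z : Multiset α, Z ≠ 0 ∧ M = X + Y ∧ N = X + Z ∧ ∀ y ∈ Y, ∃ z ∈ Z, r y z

section Orderings

variable {L : FirstOrder.Language.{u, v}} (lt : Atom L Empty → Atom L Empty → Prop)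

/-- The multiset representing a literal. -/
def Literal.toMultiset {α : Type} : Literal L α → Multiset (Atom L α)
  | .pos A => {A}
  | .neg A => {A, A}

/-- The literal ordering induced by an atom ordering. -/
def LitLT (l l' : Literal L Empty) : Prop := MultisetExt lt l.toMultiset l'.toMultiset

/-- The clause ordering induced by an atom ordering. -/
def ClauseLT (C D : Clause L Empty) : Prop := MultisetExt (LitLT lt) C.literals D.literals

/-- An atom ordering (irreflexive, total and well-founded on ground atoms) for which a
literal `¬Q(s)` is never greater than a literal `P(t)` with `s` a proper subterm of `t`. -/
structure AdmissibleOrder : Prop where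
  wellOrder : IsWellOrder (Atom L Empty) lt
  subterm : ∀ (P Q : L.Relations 1) (s t : L.Term Empty), ProperSubterm s t →
    ¬ LitLT lt (.pos (.pred P t)) (.neg (.pred Q s))

/-- The literal `l` is maximal in the clause consisting of `l` and `C`, constrained by `π`. -/
def IsMaximal (l : Literal L ℕ) (C : Clause L ℕ) (π : Constraint L ℕ) : Prop :=
  ∃ δ : ℕ → L.Term Empty, π.IsSolution δ ∧
    ∀ b ∈ C.literals, LitLT lt (b.subst δ) (l.subst δ) ∨ b.subst δ = l.subst δ

/-- The literal `l` is strictly maximal in the clause consisting of `l` and `C`, constrained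
by `π`. -/
def IsStrictlyMaximal (l : Literal L ℕ) (C : Clause L ℕ) (π : Constraint L ℕ) : Prop :=
  ∃ δ : ℕ → L.Term Empty, π.IsSolution δ ∧
    ∀ b ∈ C.literals, LitLT lt (b.subst δ) (l.subst δ)

/-! ### Inferences -/

/-- `σ` is a most general unifier of `A` and `B`. -/
def IsMGU {α : Type} (σ : α → L.Term ℕ) (A B : Atom L α) : Prop :=
  A.subst σ = B.subst σ ∧
    ∀ τ : α → L.Term ℕ, A.subst τ = B.subst τ →
      ∃ ρ : ℕ → L.Term ℕ, ∀ x, τ x = (σ x).subst ρ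

/-- SDC-resolution, `Resolution lt c₁ c₂ r`: the clause `r` is a conclusion from `c₁` and `c₂`.
The premises are renamed apart by letting the variables of the first one be
the `Sum.inl x` and those of the second one the `Sum.inr x`. -/
inductive Resolution : CClause L → CClause L → CClause L → Prop
  | mk (Γ₁ Δ₁ Γ₂ Δ₂ : Multiset (Atom L ℕ)) (A B : Atom L ℕ) (π₁ π₂ π : Constraint L ℕ)
      (σ : ℕ ⊕ ℕ → L.Term ℕ) (σ₁ σ₂ : ℕ → L.Term ℕ)
      (hσ₁ : ∀ x, σ₁ x = σ (.inl x)) (hσ₂ : ∀ x, σ₂ x = σ (.inr x))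
      (hmgu : IsMGU σ (A.subst fun x => .var (.inl x)) (B.subst fun x => .var (.inr x)))
      (hnorm : ((π₁.subst σ₁).and (π₂.subst σ₂)).NormalFormOf π)
      (hsolv : π.Solvable)
      (hmax : IsStrictlyMaximal lt (.pos (A.subst σ₁)) (Clause.subst σ₁ ⟨Γ₁, Δ₁⟩) (π₁.subst σ₁))
      (hsel : NoneSelected ⟨Γ₁, A ::ₘ Δ₁⟩)
      (hB : Selected ⟨B ::ₘ Γ₂, Δ₂⟩ B ∨
        (NoneSelected ⟨B ::ₘ Γ₂, Δ₂⟩ ∧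
          IsMaximal lt (.neg (B.subst σ₂)) (Clause.subst σ₂ ⟨Γ₂, Δ₂⟩) (π₂.subst σ₂))) :
      Resolution ⟨⟨Γ₁, A ::ₘ Δ₁⟩, π₁⟩ ⟨⟨B ::ₘ Γ₂, Δ₂⟩, π₂⟩
        ⟨⟨Γ₁.map (Atom.subst σ₁) + Γ₂.map (Atom.subst σ₂),
          Δ₁.map (Atom.subst σ₁) + Δ₂.map (Atom.subst σ₂)⟩, π⟩

/-- SDC-factoring, `Factoring lt c r`: the clause `r` is a conclusion from `c`. -/
inductive Factoring : CClause L → CClause L → Prop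
  | mk (Γ Δ : Multiset (Atom L ℕ)) (A B : Atom L ℕ) (π π' : Constraint L ℕ)
      (σ : ℕ → L.Term ℕ)
      (hmgu : IsMGU σ A B)
      (hsel : NoneSelected ⟨Γ, A ::ₘ B ::ₘ Δ⟩)
      (hmax : IsMaximal lt (.pos (A.subst σ)) (Clause.subst σ ⟨Γ, B ::ₘ Δ⟩) (π.subst σ))
      (hnorm : (π.subst σ).NormalFormOf π')
      (hsolv : π'.Solvable) :
      Factoring ⟨⟨Γ, A ::ₘ B ::ₘ Δ⟩, π⟩ ⟨Clause.subst σ ⟨Γ, A ::ₘ Δ⟩, π'⟩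

/-- `r` is the result of an inference between clauses in `N`. -/
def Inferred (N : Set (CClause L)) (r : CClause L) : Prop :=
  (∃ c₁ ∈ N, ∃ c₂ ∈ N, Resolution lt c₁ c₂ r) ∨ ∃ c ∈ N, Factoring lt c r

/-- Every ground clause `D` of `c` follows from finitely many ground clauses of `N` that are
smaller than `D`. -/
def Redundant (c : CClause L) (N : Set (CClause L)) : Prop :=
  ∀ D ∈ ground c, ∃ M : Set (Clause L Empty), M.Finite ∧
    M ⊆ {E ∈ groundSet N | ClauseLT lt E D} ∧ Entails M D

/-- Saturation up to redundancy. -/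
def Saturated (N : Set (CClause L)) : Prop :=
  ∀ r, Inferred lt N r → Redundant lt r N ∨ ground r ⊆ groundSet N

/-- One step of a saturation process: add the conclusion of an inference, possibly after
condensing it finitely often. -/
def SaturationStep (N N' : Set (CClause L)) : Prop :=
  ∃ r r', Inferred lt N r ∧ Relation.ReflTransGen (fun c c' => IsCondensationOf c' c) r r' ∧
    N' = insert r' N

end Orderings

/-- The clause is of the form `S₁(x₁), …, Sₙ(xₙ), S'₁(t), …, S'ₘ(t) → Δ` or
`S₁(x₁), …, Sₙ(xₙ), S'₁(t), …, S'ₘ(t) → S(t), Δ` where `t` is shallow and linear and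
shares no variables with `Δ`. -/
def RestrictedShape {L : FirstOrder.Language.{u, v}} (C : Clause L ℕ) : Prop :=
  ∃ (t : L.Term ℕ) (Δ : Multiset (Atom L ℕ)),
    IsShallow t ∧ IsLinearTerm t ∧ (∀ A ∈ Δ, ∀ x ∈ A.vars, x ∉ termVars t) ∧
    (∀ A ∈ C.ante, (∃ S x, A = .pred S (.var x)) ∨ ∃ S, A = .pred S t) ∧
    (C.succ = Δ ∨ ∃ S, C.succ = .pred S t ::ₘ Δ)

end MSLSDC

/-!
Both parts rest on one class of clauses, `BoundedClause F R n`: over finite sets `F` and `R` of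
function and predicate symbols, all complex terms of the antecedent have depth at most `n` and
share a reservoir of at most `n` variables, while literals `S(x)` are unrestricted. Straight
constraints in normal form only constrain variables (`Constraint.IsNormal.solved`).

*Finiteness* (`finite_ground`). Label each variable of a clause with the constraints on it, up to
renaming, and with the predicates `S` such that `S(x)` is a negative literal. There are finitely
many labels. If two positive literals carry the same labels and the first one avoids the
reservoir, then renaming the first one into the second one is a condensation
(`eq_of_relabel_varLabel_eq`); the same holds for two variables that occur neither in the
reservoir nor in the succedent (`eq_of_varLabel_eq`). So an uncondensable clause has boundedly
many variables (`exists_card_vars_le`). As a solved constraint acts on each variable separately,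
its ground clauses are determined by the clause with its variables renamed into an initial segment
of `ℕ` and by the constraints on these variables (`ground_eq_groundOf`). Hence uncondensable
bounded clauses have finitely many different sets of ground clauses. The second part of the
theorem follows, since clauses of restricted shape over a finite signature are bounded, the
reservoir being the set of variables of the distinguished shallow term.

*Closure* (`BoundedInput.resolution`, `BoundedInput.factoring`). If nothing is selected in a
clause, each of its negative literals is some `¬S(x)` with `x` properly below the argument of a
positive literal, so that the ordering prevents it from being maximal
(`NoneSelected.not_isMaximal`). Therefore the negative literal `B` resolved upon is selected. The
unifier is a matching of a shallow linear term up to a renaming (`IsMGU.exists_rename_match`): if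
the argument of `B` is complex, then the variables of the positive premise are replaced by its
arguments, and the reservoir is preserved; if the argument of `B` is a variable, then it is
replaced by the shallow linear term of the positive premise, whose variables form the new
reservoir. In both cases the succedent is renamed, except possibly for one literal `P(x)` that
becomes `P(s)`, so the conclusion is again a bounded MSL clause (`bounded_conclusion`). Factoring
matches one of the two unified literals with the other one, whose variables form the reservoir.

*Saturation* (`exists_saturation`). If a set is not saturated, then the condensed form of some
conclusion has a ground clause that the set does not have, because otherwise the conclusion itself
would be redundant (`redundant_or_ground_subset`). Adding it realizes a new one of the finitely
many possible sets of ground clauses, so this process terminates.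
-/

namespace MSLSDC

open FirstOrder.Language

/-! ### Variables, symbols and depth of terms under substitution -/

section TermLemmas

variable {L : FirstOrder.Language.{u, v}} {α β γ : Type*}

/-- The set of function symbols (with their arities) occurring in a term. -/
def termFuncs : L.Term α → Set (Σ n, L.Functions n)
  | .var _ => ∅
  | .func f ts => insert ⟨_, f⟩ (⋃ i, termFuncs (ts i))

theorem mem_termVars_func {n : ℕ} {f : L.Functions n} {ts : Fin n → L.Term α} {x : α} :
    x ∈ termVars (.func f ts) ↔ ∃ i, x ∈ termVars (ts i) := by
  simp [termVars, Multiset.mem_sum]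

theorem mem_termVars_var {x y : α} : x ∈ termVars (.var y : L.Term α) ↔ x = y := by
  simp [termVars]

theorem subst_congr {σ τ : α → L.Term β} (t : L.Term α) (h : ∀ x ∈ termVars t, σ x = τ x) :
    t.subst σ = t.subst τ := by
  induction t with
  | var x => exact h x (by simp [termVars])
  | func f ts ih =>
    simp only [Term.subst]
    congr 1
    funext i
    exact ih i fun x hx => h x (mem_termVars_func.2 ⟨i, hx⟩)

theorem subst_var (t : L.Term α) : t.subst Term.var = t := by
  induction t with
  | var x => rfl
  | func f ts ih => simp [ih]

theorem subst_subst (σ : α → L.Term β) (τ : β → L.Term γ) (t : L.Term α) :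
    (t.subst σ).subst τ = t.subst fun x => (σ x).subst τ := by
  induction t with
  | var x => rfl
  | func f ts ih => simp [ih]

theorem relabel_eq_subst (ρ : α → β) (t : L.Term α) :
    t.relabel ρ = t.subst fun x => .var (ρ x) := by
  induction t with
  | var x => rfl
  | func f ts ih => simp [ih]

theorem termVars_subst (σ : α → L.Term β) (t : L.Term α) :
    termVars (t.subst σ) = (termVars t).bind fun x => termVars (σ x) := by
  induction t with
  | var x => simp [termVars]
  | func f ts ih =>
    simp only [termVars, Term.subst, ih]
    let φ : Multiset α →+ Multiset β :=
      { toFun := fun m => m.bind fun x => termVars (σ x)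
        map_zero' := Multiset.zero_bind _
        map_add' := fun _ _ => Multiset.add_bind _ _ _ }
    exact (map_sum φ (fun i => termVars (ts i)) _).symm

theorem termVars_rename (ρ : α → β) (t : L.Term α) :
    termVars (t.subst fun x => .var (ρ x)) = (termVars t).map ρ := by
  simp [termVars_subst, termVars, Multiset.bind_singleton]

theorem termDepth_rename {σ : α → L.Term β} (t : L.Term α)
    (h : ∀ x ∈ termVars t, ∃ y, σ x = .var y) : termDepth (t.subst σ) = termDepth t := by
  induction t with
  | var x =>
    obtain ⟨y, hy⟩ := h x (by simp [termVars])
    simp [hy, termDepth]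
  | func f ts ih =>
    simp only [Term.subst, termDepth]
    congr 2
    funext i
    exact ih i fun x hx => h x (mem_termVars_func.2 ⟨i, hx⟩)

theorem termFuncs_rename {σ : α → L.Term β} (t : L.Term α)
    (h : ∀ x ∈ termVars t, ∃ y, σ x = .var y) : termFuncs (t.subst σ) = termFuncs t := by
  induction t with
  | var x =>
    obtain ⟨y, hy⟩ := h x (by simp [termVars])
    simp [hy, termFuncs]
  | func f ts ih =>
    simp only [Term.subst, termFuncs]
    congr 2
    funext i
    exact ih i fun x hx => h x (mem_termVars_func.2 ⟨i, hx⟩)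

theorem termDepth_arg_lt {n : ℕ} (f : L.Functions n) (ts : Fin n → L.Term α) (i : Fin n) :
    termDepth (ts i) < termDepth (.func f ts) := by
  have : termDepth (ts i) ≤ Finset.univ.sup fun i => termDepth (ts i) :=
    Finset.le_sup (f := fun i => termDepth (ts i)) (Finset.mem_univ i)
  simp only [termDepth]
  omega

theorem termFuncs_arg_subset {n : ℕ} (f : L.Functions n) (ts : Fin n → L.Term α) (i : Fin n) :
    termFuncs (ts i) ⊆ termFuncs (.func f ts) := fun _ hg =>
  Set.mem_insert_of_mem _ (Set.mem_iUnion.2 ⟨i, hg⟩)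

theorem finite_termFuncs (t : L.Term α) : (termFuncs t).Finite := by
  induction t with
  | var x => exact Set.finite_empty
  | func f ts ih => exact (Set.finite_iUnion ih).insert _

theorem not_isComplex {t : L.Term α} : ¬ IsComplex t ↔ ∃ x, t = .var x := by
  simp [IsComplex]

/-- A shallow term is a variable or a function symbol applied to variables. -/
theorem IsShallow.cases {t : L.Term α} (h : IsShallow t) :
    (∃ x, t = .var x) ∨ ∃ (n : ℕ) (f : L.Functions n) (y : Fin n → α),
      t = .func f fun i => .var (y i) := by
  cases t with
  | var x => exact .inl ⟨x, rfl⟩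
  | func f ts =>
    refine .inr ⟨_, f, ?_⟩
    have hv : ∀ i, ∃ y, ts i = .var y := by
      intro i
      have := termDepth_arg_lt f ts i
      have h1 : termDepth (Term.func f ts) ≤ 1 := h
      generalize ts i = s at *
      cases s with
      | var y => exact ⟨y, rfl⟩
      | func g us => simp only [termDepth] at this h1; omega
    choose y hy using hv
    exact ⟨y, by congr; funext i; exact hy i⟩

theorem termVars_flat {n : ℕ} (f : L.Functions n) (y : Fin n → α) :
    termVars (.func f fun i => .var (y i) : L.Term α) = Finset.univ.val.map y := by
  have := Multiset.sum_map_singleton (Finset.univ.val.map y)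
  rw [Multiset.map_map] at this
  exact this

theorem mem_termVars_flat {n : ℕ} {f : L.Functions n} {y : Fin n → α} {x : α} :
    x ∈ termVars (.func f fun i => .var (y i) : L.Term α) ↔ ∃ i, y i = x := by
  simp [termVars_flat]

theorem injective_of_isLinearTerm_flat {n : ℕ} {f : L.Functions n} {y : Fin n → α}
    (h : IsLinearTerm (.func f fun i => .var (y i) : L.Term α)) : Function.Injective y := by
  rw [IsLinearTerm, termVars_flat] at h
  intro i j hij
  exact Multiset.inj_on_of_nodup_map h i (Finset.mem_univ i) j (Finset.mem_univ j) hij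

/-- A shallow linear term whose variables can be labelled like those of a second term can be mapped
onto the second term by a label preserving renaming. -/
theorem exists_rename_of_label_eq {t u : L.Term α} (ℓ : α → β) (ht : IsShallow t)
    (hl : IsLinearTerm t) (h : t.relabel ℓ = u.relabel ℓ) :
    ∃ ρ : α → α, (t.subst fun x => .var (ρ x)) = u ∧ ∀ x ∈ termVars t, ℓ (ρ x) = ℓ x := by
  classical
  obtain ⟨x, rfl⟩ | ⟨n, f, y, rfl⟩ := ht.cases
  · cases u with
    | func g us => simp at h
    | var z =>
      refine ⟨fun _ => z, rfl, fun w hw => ?_⟩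
      obtain rfl := mem_termVars_var.1 hw
      simpa using h.symm
  · have hinj := injective_of_isLinearTerm_flat hl
    cases u with
    | var z => simp at h
    | func g us =>
      simp only [Term.relabel, Term.func.injEq] at h
      obtain ⟨rfl, h⟩ := h
      rw [heq_eq_eq, heq_eq_eq] at h
      obtain ⟨rfl, h⟩ := h
      have hz : ∀ i, ∃ z, us i = .var z ∧ ℓ z = ℓ (y i) := by
        intro i
        have hi := congrFun h i
        cases hu : us i with
        | var z => rw [hu] at hi; exact ⟨z, rfl, by simpa using hi.symm⟩
        | func g us => rw [hu] at hi; simp at hi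
      choose z hz hz' using hz
      refine ⟨Function.extend y z id, ?_, fun x hx => ?_⟩
      · simp only [Term.subst, Term.func.injEq, heq_eq_eq, true_and]
        funext i
        rw [hinj.extend_apply, hz]
      · obtain ⟨i, rfl⟩ := mem_termVars_flat.1 hx
        rw [hinj.extend_apply, hz']

/-- There are only finitely many terms of bounded depth over finitely many symbols and
variables. -/
theorem finite_terms {F : Set (Σ n, L.Functions n)} (hF : F.Finite) {V : Set α} (hV : V.Finite)
    (n : ℕ) :
    {t : L.Term α | termFuncs t ⊆ F ∧ termDepth t ≤ n ∧ ∀ x ∈ termVars t, x ∈ V}.Finite := by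
  induction n with
  | zero =>
    refine (hV.image Term.var).subset ?_
    rintro (x | ⟨f, ts⟩) ⟨-, h, hx⟩
    · exact ⟨x, hx x (by simp [termVars]), rfl⟩
    · simp [termDepth] at h
  | succ n ih =>
    refine ((hV.image Term.var).union (hF.biUnion (t := fun p =>
      (fun ts : Fin p.1 → L.Term α => Term.func p.2 ts) '' Set.pi Set.univ fun _ =>
        {t : L.Term α | termFuncs t ⊆ F ∧ termDepth t ≤ n ∧ ∀ x ∈ termVars t, x ∈ V})
      fun p _ => (Set.Finite.pi fun _ => ih).image _)).subset ?_
    rintro (x | ⟨f, ts⟩) ⟨hf, h, hx⟩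
    · exact .inl ⟨x, hx x (by simp [termVars]), rfl⟩
    · refine .inr (Set.mem_biUnion (hf (Set.mem_insert _ _)) ⟨ts, fun i _ => ⟨?_, ?_, ?_⟩, rfl⟩)
      · exact (termFuncs_arg_subset f ts i).trans hf
      · have := termDepth_arg_lt f ts i
        omega
      · exact fun x hxi => hx x (mem_termVars_func.2 ⟨i, hxi⟩)

theorem exists_arity_le {F : Set (Σ n, L.Functions n)} (hF : F.Finite) :
    ∃ a, ∀ p ∈ F, p.1 ≤ a := by
  obtain ⟨a, ha⟩ := (hF.image Sigma.fst).bddAbove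
  exact ⟨a, fun p hp => ha ⟨p, hp, rfl⟩⟩

/-- Terms of bounded depth over finitely many symbols have boundedly many occurrences of
variables. -/
theorem exists_card_termVars_le {F : Set (Σ n, L.Functions n)} (hF : F.Finite) (n : ℕ) :
    ∃ B, ∀ t : L.Term α, termFuncs t ⊆ F → termDepth t ≤ n → (termVars t).card ≤ B := by
  obtain ⟨a, ha⟩ := exists_arity_le hF
  induction n with
  | zero =>
    refine ⟨1, ?_⟩
    rintro (x | ⟨f, ts⟩) - h
    · simp [termVars]
    · simp [termDepth] at h
  | succ n ih =>
    obtain ⟨B, hB⟩ := ih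
    refine ⟨1 + a * B, ?_⟩
    rintro (x | ⟨f, ts⟩) hf h
    · simp [termVars]
    · rename_i k
      have h1 : (termVars (Term.func f ts)).card ≤ k * B := by
        simp only [termVars, Multiset.card_sum]
        refine (Finset.sum_le_card_nsmul Finset.univ _ B fun i _ => hB _ ?_ ?_).trans (by simp)
        · exact (termFuncs_arg_subset f ts i).trans hf
        · have := termDepth_arg_lt f ts i
          omega
      have h2 : k ≤ a := ha ⟨k, f⟩ (hf (Set.mem_insert _ _))
      nlinarith [Nat.mul_le_mul_right B h2]

theorem exists_rename_lt (V : Finset ℕ) {M : ℕ} (h : V.card ≤ M) :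
    ∃ r r' : ℕ → ℕ, ∀ x ∈ V, r x < M ∧ r' (r x) = x := by
  classical
  refine ⟨fun x => if hx : x ∈ V then V.equivFin ⟨x, hx⟩ else 0,
    fun i => if hi : i < V.card then V.equivFin.symm ⟨i, hi⟩ else 0, fun x hx => ?_⟩
  simp only [hx, dif_pos, Fin.is_lt, Fin.eta, Equiv.symm_apply_apply, and_true]
  exact (Fin.is_lt _).trans_le h

theorem RenamingEquiv.refl (s : L.Term α) : RenamingEquiv s s :=
  ⟨⟨id, s.relabel_id⟩, ⟨id, s.relabel_id⟩⟩

theorem RenamingEquiv.symm {s t : L.Term α} (h : RenamingEquiv s t) : RenamingEquiv t s :=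
  ⟨h.2, h.1⟩

theorem RenamingEquiv.trans {s t u : L.Term α} (h : RenamingEquiv s t) (h' : RenamingEquiv t u) :
    RenamingEquiv s u := by
  obtain ⟨⟨ρ, rfl⟩, ⟨ρ', h1⟩⟩ := h
  obtain ⟨⟨τ, rfl⟩, ⟨τ', h2⟩⟩ := h'
  refine ⟨⟨τ ∘ ρ, by simp⟩, ⟨ρ' ∘ τ', ?_⟩⟩
  rw [← Term.relabel_relabel, h2, h1]

theorem RenamingEquiv.exists_instance_iff {s t : L.Term α} (h : RenamingEquiv s t)
    (w : L.Term β) : (∃ τ, w = s.subst τ) ↔ ∃ τ, w = t.subst τ := by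
  have key : ∀ {s t : L.Term α}, RenamingEquiv s t → (∃ τ, w = s.subst τ) →
      ∃ τ, w = t.subst τ := by
    rintro s t ⟨-, ρ, rfl⟩ ⟨τ, rfl⟩
    exact ⟨fun x => τ (ρ x), by rw [relabel_eq_subst, subst_subst]; rfl⟩
  exact ⟨key h, key h.symm⟩

/-- Finitely many terms represent, up to renaming, all terms of bounded depth over finitely many
symbols. -/
theorem exists_finite_representatives {F : Set (Σ n, L.Functions n)} (hF : F.Finite) (n : ℕ) :
    ∃ T : Set (L.Term ℕ), T.Finite ∧
      ∀ s, termFuncs s ⊆ F → termDepth s ≤ n → ∃ t ∈ T, RenamingEquiv s t := by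
  obtain ⟨B, hB⟩ := exists_card_termVars_le (α := ℕ) hF n
  refine ⟨_, finite_terms hF (Set.finite_lt_nat B) n, fun s hs hn => ?_⟩
  obtain ⟨r, r', hr⟩ := exists_rename_lt (termVars s).toFinset
    ((Multiset.toFinset_card_le _).trans (hB s hs hn))
  simp only [Multiset.mem_toFinset] at hr
  have hv : ∀ x ∈ termVars s, ∃ y, (Term.var (r x) : L.Term ℕ) = .var y := fun x _ => ⟨_, rfl⟩
  refine ⟨s.subst fun x => .var (r x), ⟨?_, ?_, ?_⟩, ⟨r, relabel_eq_subst _ _⟩, r', ?_⟩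
  · rwa [termFuncs_rename _ hv]
  · rwa [termDepth_rename _ hv]
  · intro x hx
    rw [termVars_rename, Multiset.mem_map] at hx
    obtain ⟨y, hy, rfl⟩ := hx
    exact (hr y hy).1
  · rw [relabel_eq_subst, subst_subst, subst_congr s (τ := Term.var), subst_var]
    intro x hx
    simp [(hr x hx).2]

theorem properSubterm_subst_of_mem_termVars {σ : α → L.Term β} {s : L.Term α} {x : α}
    (hs : IsComplex s) (hx : x ∈ termVars s) : ProperSubterm (σ x) (s.subst σ) := by
  induction s with
  | var y => exact absurd rfl (hs y)
  | func f ts ih =>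
    obtain ⟨i, hi⟩ := mem_termVars_func.1 hx
    by_cases hc : IsComplex (ts i)
    · exact .deep f _ i _ (ih i hc hi)
    · obtain ⟨y, hy⟩ := not_isComplex.1 hc
      rw [hy, mem_termVars_var] at hi
      subst hi
      have := ProperSubterm.arg f (fun j => (ts j).subst σ) i
      rwa [hy] at this

end TermLemmas

/-! ### Atoms and clauses under substitution -/

section ClauseLemmas

variable {L : FirstOrder.Language.{u, v}} {α β γ : Type}

theorem Atom.subst_congr {σ τ : α → L.Term β} (A : Atom L α) (h : ∀ x ∈ A.vars, σ x = τ x) :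
    A.subst σ = A.subst τ := by
  cases A with
  | pred P t => exact congrArg _ (MSLSDC.subst_congr t h)
  | eqn s t =>
    exact congrArg₂ Atom.eqn (MSLSDC.subst_congr s fun x hx => h x (Multiset.mem_add.2 (.inl hx)))
      (MSLSDC.subst_congr t fun x hx => h x (Multiset.mem_add.2 (.inr hx)))

theorem Atom.subst_var (A : Atom L α) : A.subst Term.var = A := by
  cases A <;> simp [Atom.subst, MSLSDC.subst_var]

theorem Atom.subst_subst (σ : α → L.Term β) (τ : β → L.Term γ) (A : Atom L α) :
    (A.subst σ).subst τ = A.subst fun x => (σ x).subst τ := by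
  cases A <;> simp [Atom.subst, MSLSDC.subst_subst]

theorem Atom.subst_eq_self {σ : α → L.Term α} (A : Atom L α) (h : ∀ x ∈ A.vars, σ x = .var x) :
    A.subst σ = A :=
  (A.subst_congr h).trans A.subst_var

/-- The multiset of variable occurrences of a clause. -/
def Clause.vars (C : Clause L α) : Multiset α := (C.ante + C.succ).bind Atom.vars

theorem Clause.mem_vars {C : Clause L α} {x : α} :
    x ∈ C.vars ↔ ∃ A, (A ∈ C.ante ∨ A ∈ C.succ) ∧ x ∈ A.vars := by
  simp [Clause.vars, or_and_right, exists_or]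

theorem Clause.mem_succVars {C : Clause L α} {x : α} :
    x ∈ C.succVars ↔ ∃ A ∈ C.succ, x ∈ A.vars := by
  simp [Clause.succVars]

theorem Clause.subst_congr {σ τ : α → L.Term β} (C : Clause L α)
    (h : ∀ x ∈ C.vars, σ x = τ x) : C.subst σ = C.subst τ := by
  simp only [Clause.subst, Clause.mk.injEq]
  constructor <;> refine Multiset.map_congr rfl fun A hA => A.subst_congr fun x hx => h x ?_
  · exact Clause.mem_vars.2 ⟨A, .inl hA, hx⟩
  · exact Clause.mem_vars.2 ⟨A, .inr hA, hx⟩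

theorem Clause.subst_subst (σ : α → L.Term β) (τ : β → L.Term γ) (C : Clause L α) :
    (C.subst σ).subst τ = C.subst fun x => (σ x).subst τ := by
  simp [Clause.subst, Atom.subst_subst]

theorem Clause.disjoint_vars_of_nodup {C : Clause L α} (h : C.succVars.Nodup) {A B : Atom L α}
    (hA : A ∈ C.succ) (hB : B ∈ C.succ) (hne : A ≠ B) {x : α} (hx : x ∈ A.vars) :
    x ∉ B.vars := by
  obtain ⟨s, hs⟩ := Multiset.exists_cons_of_mem hA
  have hB' : B ∈ s := by
    rw [hs, Multiset.mem_cons] at hB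
    exact hB.resolve_left (Ne.symm hne)
  rw [Clause.succVars, hs, Multiset.cons_bind, Multiset.nodup_add] at h
  intro hxB
  exact Multiset.disjoint_left.1 h.2.2 hx (Multiset.mem_bind.2 ⟨B, hB', hxB⟩)

theorem Clause.nodup_vars_of_nodup {C : Clause L α} (h : C.succVars.Nodup) {A : Atom L α}
    (hA : A ∈ C.succ) : A.vars.Nodup := by
  obtain ⟨s, hs⟩ := Multiset.exists_cons_of_mem hA
  rw [Clause.succVars, hs, Multiset.cons_bind, Multiset.nodup_add] at h
  exact h.1

end ClauseLemmas

/-! ### Bounded clauses -/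

section Bounded

variable {L : FirstOrder.Language.{u, v}}

/-- The clause uses the function symbols `F` and the predicates `R`, contains no equations, and all
its complex negative literals have depth at most `n` and share a reservoir `V` of at most `n`
variables. The negative literals `S(x)` are not restricted in this way. -/
structure BoundedClause (F : Set (Σ n, L.Functions n)) (R : Set (L.Relations 1)) (n : ℕ)
    (C : Clause L ℕ) : Prop where
  ante : ∃ V : Finset ℕ, V.card ≤ n ∧ ∀ A ∈ C.ante, ∃ S ∈ R, ∃ t, A = .pred S t ∧
    ((∃ x, t = .var x) ∨ (∀ x ∈ termVars t, x ∈ V) ∧ termFuncs t ⊆ F ∧ termDepth t ≤ n)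
  succ : ∀ A ∈ C.succ, ∃ P ∈ R, ∃ t, A = .pred P t ∧ termFuncs t ⊆ F

/-- All right-hand sides of the constraint are straight terms of depth at most `n` over the function
symbols `F`. -/
def BoundedConstraint (F : Set (Σ n, L.Functions n)) (n : ℕ) : Constraint L ℕ → Prop
  | .bot => True
  | .conj m => ∀ d ∈ m, IsStraight d.rhs ∧ termFuncs d.rhs ⊆ F ∧ termDepth d.rhs ≤ n

/-- All left-hand sides of the constraint are variables. -/
def Constraint.Solved : Constraint L ℕ → Prop
  | .bot => True
  | .conj m => ∀ d ∈ m, ∃ x, d.lhs = .var x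

/-- Normal forms of straight constraints only constrain variables. -/
theorem Constraint.IsNormal.solved {π : Constraint L ℕ} (h : π.IsNormal)
    (hs : π.IsStraightConstraint) : π.Solved := by
  cases π with
  | bot => trivial
  | conj m =>
    intro d hd
    obtain ⟨m', rfl⟩ := Multiset.exists_cons_of_mem hd
    obtain ⟨l, r⟩ := d
    cases l with
    | var x => exact ⟨x, rfl⟩
    | func f ts =>
      exfalso
      have hr : IsStraight r := hs _ hd
      cases hr with
      | var x => exact h _ (.clashVar m' f ts x)
      | @flat k g y hy =>
        by_cases hfg : (⟨_, f⟩ : Σ l, L.Functions l) = ⟨_, g⟩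
        · obtain ⟨rfl, hfg⟩ := Sigma.mk.inj_iff.1 hfg
          obtain rfl := eq_of_heq hfg
          exact h _ (.clashFlat m' f ts y)
        · exact h _ (.differ m' f ts g _ hfg)
      | @nest k g ss i y hi hv hinj hnot =>
        by_cases hfg : (⟨_, f⟩ : Σ l, L.Functions l) = ⟨_, g⟩
        · obtain ⟨rfl, hfg⟩ := Sigma.mk.inj_iff.1 hfg
          obtain rfl := eq_of_heq hfg
          by_cases hc : IsComplex (ss i)
          · exact h _ (.descend m' f ts ss i hc)
          · have hv' : ∀ j, ∃ z, ss j = .var z := fun j => by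
              by_cases hj : j = i
              · exact hj ▸ not_isComplex.1 hc
              · exact ⟨_, hv j hj⟩
            choose z hz using hv'
            obtain rfl : ss = fun j => .var (z j) := funext hz
            exact h _ (.clashFlat m' f ts z)
        · exact h _ (.differ m' f ts g _ hfg)

theorem IsStraight.arg {n : ℕ} {f : L.Functions n} {ss : Fin n → L.Term ℕ} {i : Fin n}
    (h : IsStraight (.func f ss)) (hi : IsComplex (ss i)) : IsStraight (ss i) := by
  cases h with
  | flat f y hy => exact absurd rfl (hi (y i))
  | nest f ss j y hs hvar hinj hnot =>
    by_cases hj : i = j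
    · exact hj ▸ hs
    · exact absurd (hvar i hj) (hi _)

theorem BoundedConstraint.normStep {F : Set (Σ n, L.Functions n)} {n : ℕ} {π π' : Constraint L ℕ}
    (h : BoundedConstraint F n π) (hstep : π.NormStep π') : BoundedConstraint F n π' := by
  cases hstep with
  | clashVar => trivial
  | clashFlat => trivial
  | descend m f ts ss i hi =>
    simp only [BoundedConstraint, Multiset.mem_cons, forall_eq_or_imp] at h ⊢
    exact ⟨⟨h.1.1.arg hi, (termFuncs_arg_subset f ss i).trans h.1.2.1,
      (termDepth_arg_lt f ss i).le.trans h.1.2.2⟩, h.2⟩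
  | differ =>
    simp only [BoundedConstraint, Multiset.mem_cons, forall_eq_or_imp] at h ⊢
    exact h.2
  | subsume =>
    simp only [BoundedConstraint, Multiset.mem_cons, forall_eq_or_imp] at h ⊢
    exact ⟨h.1, h.2.2⟩

theorem BoundedConstraint.normalForm {F : Set (Σ n, L.Functions n)} {n : ℕ}
    {π π' : Constraint L ℕ} (h : BoundedConstraint F n π) (hnf : π.NormalFormOf π') :
    BoundedConstraint F n π' := by
  obtain ⟨hsteps, -⟩ := hnf
  induction hsteps with
  | refl => exact h
  | tail _ hstep ih => exact ih.normStep hstep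

theorem BoundedConstraint.isStraightConstraint {F : Set (Σ n, L.Functions n)} {n : ℕ}
    {π : Constraint L ℕ} (h : BoundedConstraint F n π) : π.IsStraightConstraint := by
  cases π with
  | bot => trivial
  | conj m => exact fun d hd => (h d hd).1

/-! ### Condensation by renaming -/

theorem exists_condensation_of_rename {C C' : Clause L ℕ} {m : Multiset (Diseq L ℕ)} (ρ : ℕ → ℕ)
    (hsub : C'.ProperSub C) (hm : Constraint.Solved (.conj m)) (hidem : ∀ x, ρ (ρ x) = ρ x)
    (hρ : ∀ x s, ⟨.var x, s⟩ ∈ m → ∃ s', ⟨.var (ρ x), s'⟩ ∈ m ∧ RenamingEquiv s s')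
    (hante : ∀ A ∈ C.ante, A.subst (fun x => .var (ρ x)) ∈ C'.ante)
    (hsucc : ∀ A ∈ C.succ, A.subst (fun x => .var (ρ x)) ∈ C'.succ) :
    ∃ c', IsCondensationOf c' ⟨C, .conj m⟩ := by
  classical
  refine ⟨⟨C', .conj (m.filter fun d => d.subst (fun x => .var (ρ x)) = d)⟩, hsub,
    Multiset.filter_subset _ _, fun x => .var (ρ x), ⟨?_, ?_⟩, ?_⟩
  · intro d hd
    obtain ⟨⟨l, s⟩, hs, rfl⟩ := Multiset.mem_map.1 hd
    obtain ⟨x, rfl⟩ : ∃ x, l = .var x := hm _ hs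
    obtain ⟨s', hs', hequiv⟩ := hρ x s hs
    exact ⟨_, Multiset.mem_filter.2 ⟨hs', by simp [Diseq.subst, hidem]⟩, rfl, hequiv⟩
  · intro e he
    obtain ⟨he, heq⟩ := Multiset.mem_filter.1 he
    exact ⟨e, Multiset.mem_map.2 ⟨e, he, heq⟩, rfl, .refl _⟩
  · intro l hl
    simp only [Clause.literals, Multiset.mem_add, Multiset.mem_map] at hl ⊢
    obtain ⟨A, hA, rfl⟩ | ⟨A, hA, rfl⟩ := hl
    · exact .inl ⟨_, hante A hA, rfl⟩
    · exact .inr ⟨_, hsucc A hA, rfl⟩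

/-- Uncondensable clauses contain no duplicate literals. -/
theorem nodup_of_no_condensation {C : Clause L ℕ} {m : Multiset (Diseq L ℕ)}
    (hm : Constraint.Solved (.conj m)) (hc : ∀ c', ¬ IsCondensationOf c' ⟨C, .conj m⟩) :
    C.ante.Nodup ∧ C.succ.Nodup := by
  have hid : ∀ A : Atom L ℕ, (A.subst fun x => .var (id x)) = A := Atom.subst_var
  constructor <;> rw [Multiset.nodup_iff_ne_cons_cons] <;> rintro a s h
  · obtain ⟨c', h'⟩ := exists_condensation_of_rename (C := C) (C' := ⟨a ::ₘ s, C.succ⟩) id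
      ⟨by rw [h]; exact Multiset.le_cons_self _ _, le_rfl, fun h' => by
        have := congrArg (fun D => D.ante.card) h'
        simp [h] at this⟩ hm (fun _ => rfl) (fun x s h => ⟨s, h, .refl _⟩)
      (fun A hA => by rw [hid]; simpa [h] using hA) (fun A hA => by rwa [hid])
    exact hc _ h'
  · obtain ⟨c', h'⟩ := exists_condensation_of_rename (C := C) (C' := ⟨C.ante, a ::ₘ s⟩) id
      ⟨le_rfl, by rw [h]; exact Multiset.le_cons_self _ _, fun h' => by
        have := congrArg (fun D => D.succ.card) h'
        simp [h] at this⟩ hm (fun _ => rfl) (fun x s h => ⟨s, h, .refl _⟩)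
      (fun A hA => by rwa [hid]) (fun A hA => by rw [hid]; simpa [h] using hA)
    exact hc _ h'

/-- The label of a variable: the constraints on the variable, up to renaming and given by their
representatives in `T`, and the predicates it is the argument of in the antecedent. -/
def varLabel (T : Set (L.Term ℕ)) (C : Clause L ℕ) (m : Multiset (Diseq L ℕ)) (x : ℕ) :
    Set (L.Term ℕ) × Set (L.Relations 1) :=
  ({t ∈ T | ∃ s, ⟨.var x, s⟩ ∈ m ∧ RenamingEquiv s t}, {S | .pred S (.var x) ∈ C.ante})

theorem exists_diseq_of_varLabel_eq {T : Set (L.Term ℕ)} {C : Clause L ℕ}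
    {m : Multiset (Diseq L ℕ)} (hT : ∀ d ∈ m, ∃ t ∈ T, RenamingEquiv d.rhs t) {x y : ℕ}
    (h : varLabel T C m y = varLabel T C m x) {s : L.Term ℕ} (hs : ⟨.var x, s⟩ ∈ m) :
    ∃ s', ⟨.var y, s'⟩ ∈ m ∧ RenamingEquiv s s' := by
  obtain ⟨t, ht, hst⟩ := hT _ hs
  have : t ∈ (varLabel T C m y).1 := by rw [h]; exact ⟨ht, s, hs, hst⟩
  obtain ⟨-, s', hs', hst'⟩ := this
  exact ⟨s', hs', hst.trans hst'.symm⟩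

theorem pred_mem_ante_of_varLabel_eq {T : Set (L.Term ℕ)} {C : Clause L ℕ}
    {m : Multiset (Diseq L ℕ)} {x y : ℕ} (h : varLabel T C m y = varLabel T C m x)
    {S : L.Relations 1} (hS : .pred S (.var x) ∈ C.ante) : .pred S (.var y) ∈ C.ante := by
  have : S ∈ (varLabel T C m y).2 := by rw [h]; exact hS
  exact this

/-- In an uncondensable clause, two variables that occur neither in the reservoir `V` nor in the
succedent have different labels: otherwise the first one could be replaced by the second one. -/
theorem eq_of_varLabel_eq {T : Set (L.Term ℕ)} {C : Clause L ℕ} {m : Multiset (Diseq L ℕ)}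
    {V : Finset ℕ} (hV : ∀ A ∈ C.ante, ∃ S t, A = .pred S t ∧
      ((∃ x, t = .var x) ∨ ∀ x ∈ termVars t, x ∈ V))
    (hm : Constraint.Solved (.conj m)) (hT : ∀ d ∈ m, ∃ t ∈ T, RenamingEquiv d.rhs t)
    (hc : ∀ c', ¬ IsCondensationOf c' ⟨C, .conj m⟩) {x y : ℕ} {S : L.Relations 1}
    (hx : .pred S (.var x) ∈ C.ante) (hxV : x ∉ V) (hxΔ : x ∉ C.succVars)
    (h : varLabel T C m y = varLabel T C m x) : x = y := by
  classical
  by_contra hne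
  have hfix : ∀ z, z ≠ x → Function.update id x y z = z := fun z hz => by simp [hz]
  have hpred : ∀ S' z, Atom.pred S' (.var z) ∈ C.ante → z ≠ x →
      Atom.pred S' (.var z) ∈ C.ante.erase (.pred S (.var x)) := fun S' z hz hzx =>
    (Multiset.mem_erase_of_ne (by simp [hzx])).2 hz
  refine not_exists.2 hc (exists_condensation_of_rename (C := C) (m := m)
    (C' := ⟨C.ante.erase (.pred S (.var x)), C.succ⟩) (Function.update id x y)
    ⟨Multiset.erase_le _ _, le_rfl, fun h' => by
      have h1 := congrArg (fun D => D.ante.card) h'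
      have h2 := Multiset.card_erase_lt_of_mem hx
      simp only at h1
      omega⟩ hm ?_ ?_ ?_ ?_)
  · intro z
    by_cases hz : z = x
    · subst hz; simp [Ne.symm hne]
    · rw [hfix z hz, hfix z hz]
  · intro z s hs
    by_cases hz : z = x
    · subst hz
      simpa using exists_diseq_of_varLabel_eq hT h hs
    · rw [hfix z hz]; exact ⟨s, hs, .refl _⟩
  · intro A hA
    obtain ⟨S', t, rfl, ⟨z, rfl⟩ | ht⟩ := hV A hA
    · by_cases hz : z = x
      · subst hz
        simpa [Atom.subst] using hpred S' y (pred_mem_ante_of_varLabel_eq h hA) (Ne.symm hne)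
      · simpa [Atom.subst, hfix z hz] using hpred S' z hA hz
    · rw [Atom.subst_eq_self]
      · refine (Multiset.mem_erase_of_ne ?_).2 hA
        rintro ⟨⟩
        exact hxV (ht x (by simp [termVars]))
      · intro z hz
        rw [hfix z]
        rintro rfl
        exact hxV (ht _ hz)
  · intro A hA
    rw [Atom.subst_eq_self]
    · exact hA
    · intro z hz
      rw [hfix z]
      rintro rfl
      exact hxΔ (Clause.mem_succVars.2 ⟨A, hA, hz⟩)

/-- In an uncondensable clause, a positive literal that is variable disjoint from the reservoir `V`
differs from all other positive literals in its labelled term: otherwise it could be renamed into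
the other literal. -/
theorem eq_of_relabel_varLabel_eq {T : Set (L.Term ℕ)} {C : Clause L ℕ}
    {m : Multiset (Diseq L ℕ)}
    {V : Finset ℕ} (hV : ∀ A ∈ C.ante, ∃ S t, A = .pred S t ∧
      ((∃ x, t = .var x) ∨ ∀ x ∈ termVars t, x ∈ V))
    (hm : Constraint.Solved (.conj m)) (hT : ∀ d ∈ m, ∃ t ∈ T, RenamingEquiv d.rhs t)
    (hc : ∀ c', ¬ IsCondensationOf c' ⟨C, .conj m⟩) (hC : C.succVars.Nodup)
    {P : L.Relations 1} {s t : L.Term ℕ} (hs : .pred P s ∈ C.succ) (ht : .pred P t ∈ C.succ)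
    (hshallow : IsShallow s) (hsV : ∀ x ∈ termVars s, x ∉ V)
    (h : s.relabel (varLabel T C m) = t.relabel (varLabel T C m)) : s = t := by
  classical
  by_contra hne
  have hne' : Atom.pred P s ≠ .pred P t := by simpa using hne
  obtain ⟨ρ₀, hρ₀, hlab⟩ := exists_rename_of_label_eq _ hshallow
    (Clause.nodup_vars_of_nodup hC hs) h
  -- outside of `s` the renaming is the identity, in particular on its own range
  let ρ : ℕ → ℕ := fun x => if x ∈ termVars s then ρ₀ x else x
  have hρs : ∀ x ∈ termVars s, ρ x = ρ₀ x := fun x hx => if_pos hx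
  have hρn : ∀ x, x ∉ termVars s → ρ x = x := fun x hx => if_neg hx
  have hst : (s.subst fun x => .var (ρ x)) = t := by
    rw [← hρ₀]
    exact subst_congr _ fun x hx => by rw [hρs x hx]
  have hlab' : ∀ x, varLabel T C m (ρ x) = varLabel T C m x := fun x => by
    by_cases hx : x ∈ termVars s
    · rw [hρs x hx, hlab x hx]
    · rw [hρn x hx]
  have hrange : ∀ x ∈ termVars s, ρ x ∉ termVars s := fun x hx hx' => by
    have : ρ x ∈ termVars t := by
      rw [← hst, termVars_rename]
      exact Multiset.mem_map_of_mem _ hx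
    exact Clause.disjoint_vars_of_nodup hC hs ht hne' hx' this
  refine not_exists.2 hc (exists_condensation_of_rename (C := C) (m := m)
    (C' := ⟨C.ante, C.succ.erase (.pred P s)⟩) ρ
    ⟨le_rfl, Multiset.erase_le _ _, fun h' => by
      have h1 := congrArg (fun D => D.succ.card) h'
      have h2 := Multiset.card_erase_lt_of_mem hs
      simp only at h1
      omega⟩ hm ?_ ?_ ?_ ?_)
  · intro x
    by_cases hx : x ∈ termVars s
    · exact hρn _ (hrange x hx)
    · rw [hρn x hx, hρn x hx]
  · exact fun x s' hs' => exists_diseq_of_varLabel_eq hT (hlab' x) hs'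
  · intro A hA
    obtain ⟨S', u, rfl, ⟨z, rfl⟩ | hu⟩ := hV A hA
    · exact pred_mem_ante_of_varLabel_eq (hlab' z) hA
    · rwa [Atom.subst_eq_self]
      exact fun z hz => by rw [hρn z fun hzs => hsV z hzs (hu z hz)]
  · intro A hA
    by_cases hAs : A = .pred P s
    · subst hAs
      simp only [Atom.subst, hst]
      exact (Multiset.mem_erase_of_ne (Ne.symm hne')).2 ht
    · rw [Atom.subst_eq_self]
      · exact (Multiset.mem_erase_of_ne hAs).2 hA
      · exact fun z hz => by rw [hρn z (Clause.disjoint_vars_of_nodup hC hA hs hAs hz)]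

end Bounded

/-! ### Finitely many uncondensable bounded clauses -/

section Finiteness

variable {L : FirstOrder.Language.{u, v}}

/-- The number of variables of uncondensable bounded clauses is bounded. The variables outside the
reservoir either occur in positive literals, of which only boundedly many meet the reservoir while
the others differ in their labelled terms, or they are determined by their labels. -/
theorem exists_card_vars_le {F : Set (Σ n, L.Functions n)} (hF : F.Finite)
    {R : Set (L.Relations 1)} (hR : R.Finite) (n : ℕ) {T : Set (L.Term ℕ)} (hTf : T.Finite) :
    ∃ M, ∀ (C : Clause L ℕ) (m : Multiset (Diseq L ℕ)), IsMSL C → BoundedClause F R n C →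
      Constraint.Solved (.conj m) → (∀ d ∈ m, ∃ t ∈ T, RenamingEquiv d.rhs t) →
      (∀ c', ¬ IsCondensationOf c' ⟨C, .conj m⟩) → C.vars.toFinset.card ≤ M := by
  classical
  obtain ⟨B, hB⟩ := exists_card_termVars_le (α := ℕ) hF 1
  have hΛ : (𝒫 T ×ˢ 𝒫 R).Finite := hTf.finite_subsets.prod hR.finite_subsets
  have hQ := hR.prod (finite_terms hF hΛ 1)
  refine ⟨n + (n * B + hQ.toFinset.card * B) + hΛ.toFinset.card, fun C m hC hb hm hT hc => ?_⟩
  obtain ⟨V, hVn, hV⟩ := hb.ante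
  have hV' : ∀ A ∈ C.ante, ∃ S t, A = .pred S t ∧
      ((∃ x, t = .var x) ∨ ∀ x ∈ termVars t, x ∈ V) := fun A hA => by
    obtain ⟨S, -, t, rfl, ht⟩ := hV A hA
    exact ⟨S, t, rfl, ht.imp_right And.left⟩
  have hlab : ∀ x, varLabel T C m x ∈ 𝒫 T ×ˢ 𝒫 R := fun x => by
    refine ⟨fun t ht => ht.1, fun S hS => ?_⟩
    obtain ⟨S', hS', t, heq, -⟩ := hV _ hS
    cases heq
    exact hS'
  have hsucc : ∀ A ∈ C.succ, ∃ P ∈ R, ∃ t, A = .pred P t ∧ termFuncs t ⊆ F ∧ IsShallow t :=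
    fun A hA => by
      obtain ⟨P, hP, t, rfl, hF⟩ := hb.succ A hA
      obtain ⟨P', t', heq, ht⟩ := hC.shallow _ hA
      cases heq
      exact ⟨P, hP, t, rfl, hF, ht⟩
  have hvB : ∀ A ∈ C.succ, A.vars.toFinset.card ≤ B := fun A hA => by
    obtain ⟨P, -, t, rfl, hF, ht⟩ := hsucc A hA
    exact (Multiset.toFinset_card_le _).trans (hB t hF ht)
  let ΔV := C.succ.toFinset.filter fun A => ∃ x ∈ A.vars, x ∈ V
  let Δf := C.succ.toFinset.filter fun A => ¬ ∃ x ∈ A.vars, x ∈ V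
  let W := C.vars.toFinset.filter fun x =>
    (∃ S, Atom.pred S (.var x) ∈ C.ante) ∧ x ∉ V ∧ x ∉ C.succVars
  have hΔV : ΔV.card ≤ n := by
    refine le_trans ?_ hVn
    refine Finset.card_le_card_of_forall_subsingleton (fun A x => x ∈ A.vars)
      (fun A hA => ?_) fun x _ A hA A' hA' => ?_
    · obtain ⟨x, hx⟩ := (Finset.mem_filter.1 hA).2
      exact ⟨x, hx.2, hx.1⟩
    · by_contra hne
      have hmem : ∀ A ∈ ΔV, A ∈ C.succ := fun A hA =>
        Multiset.mem_toFinset.1 (Finset.mem_filter.1 hA).1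
      exact Clause.disjoint_vars_of_nodup hC.linear (hmem A hA.1) (hmem A' hA'.1) hne hA.2 hA'.2
  have hΔf : Δf.card ≤ hQ.toFinset.card := by
    have hΔ : ∀ A ∈ Δf, ∃ P ∈ R, ∃ t, A = .pred P t ∧ A ∈ C.succ ∧ termFuncs t ⊆ F ∧
        IsShallow t ∧ ∀ x ∈ termVars t, x ∉ V := fun A hA => by
      obtain ⟨hA, hAV⟩ := Finset.mem_filter.1 hA
      rw [Multiset.mem_toFinset] at hA
      obtain ⟨P, hP, t, rfl, hF, ht⟩ := hsucc A hA
      exact ⟨P, hP, t, rfl, hA, hF, ht, fun x hx hxV => hAV ⟨x, hx, hxV⟩⟩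
    refine Finset.card_le_card_of_forall_subsingleton
      (fun A p => ∃ t, A = .pred p.1 t ∧ p.2 = t.relabel (varLabel T C m)) (fun A hA => ?_) ?_
    · obtain ⟨P, hP, t, rfl, -, hF, hs, -⟩ := hΔ A hA
      refine ⟨(P, t.relabel (varLabel T C m)), hQ.mem_toFinset.2 ⟨hP, ?_, ?_, fun x hx => ?_⟩,
        t, rfl, rfl⟩
      all_goals simp only [relabel_eq_subst] at *
      · rwa [termFuncs_rename _ fun x _ => ⟨_, rfl⟩]
      · rwa [termDepth_rename _ fun x _ => ⟨_, rfl⟩]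
      · simp only [termVars_rename, Multiset.mem_map] at hx
        obtain ⟨y, -, rfl⟩ := hx
        exact hlab y
    · rintro ⟨P, u⟩ - A ⟨hA, s, rfl, rfl⟩ A' ⟨hA', t, rfl, heq⟩
      obtain ⟨_, -, _, h, hA1, -, hs, htV⟩ := hΔ _ hA
      cases h
      obtain ⟨_, -, _, h, hA1', -⟩ := hΔ _ hA'
      cases h
      rw [eq_of_relabel_varLabel_eq hV' hm hT hc hC.linear hA1 hA1' hs htV heq]
  have hW : W.card ≤ hΛ.toFinset.card := by
    refine Finset.card_le_card_of_injOn (varLabel T C m)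
      (fun x _ => hΛ.mem_toFinset.2 (hlab x)) fun x hx y hy heq => ?_
    obtain ⟨-, ⟨S, hS⟩, hxV, hxΔ⟩ := Finset.mem_filter.1 hx
    exact eq_of_varLabel_eq hV' hm hT hc hS hxV hxΔ heq.symm
  have hsub : C.vars.toFinset ⊆ V ∪ (ΔV.biUnion (fun A => A.vars.toFinset) ∪
      Δf.biUnion fun A => A.vars.toFinset) ∪ W := by
    intro x hx
    by_cases hxV : x ∈ V
    · simp [hxV]
    by_cases hxΔ : x ∈ C.succVars
    · obtain ⟨A, hA, hxA⟩ := Clause.mem_succVars.1 hxΔ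
      by_cases hAV : ∃ x ∈ A.vars, x ∈ V
      · refine Finset.mem_union_left _ (Finset.mem_union_right _ (Finset.mem_union_left _ ?_))
        exact Finset.mem_biUnion.2 ⟨A, Finset.mem_filter.2 ⟨Multiset.mem_toFinset.2 hA, hAV⟩,
          Multiset.mem_toFinset.2 hxA⟩
      · refine Finset.mem_union_left _ (Finset.mem_union_right _ (Finset.mem_union_right _ ?_))
        exact Finset.mem_biUnion.2 ⟨A, Finset.mem_filter.2 ⟨Multiset.mem_toFinset.2 hA, hAV⟩,
          Multiset.mem_toFinset.2 hxA⟩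
    · refine Finset.mem_union_right _ (Finset.mem_filter.2 ⟨hx, ?_, hxV, hxΔ⟩)
      obtain ⟨A, hA | hA, hxA⟩ := Clause.mem_vars.1 (Multiset.mem_toFinset.1 hx)
      · obtain ⟨S, t, rfl, ⟨z, rfl⟩ | ht⟩ := hV' A hA
        · obtain rfl : x = z := (mem_termVars_var (L := L)).1 hxA
          exact ⟨S, hA⟩
        · exact absurd (ht x hxA) hxV
      · exact absurd (Clause.mem_succVars.2 ⟨A, hA, hxA⟩) hxΔ
  have h1 : (ΔV.biUnion fun A => A.vars.toFinset).card ≤ ΔV.card * B :=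
    Finset.card_biUnion_le_card_mul _ _ _ fun A hA =>
      hvB A (Multiset.mem_toFinset.1 (Finset.mem_filter.1 hA).1)
  have h2 : (Δf.biUnion fun A => A.vars.toFinset).card ≤ Δf.card * B :=
    Finset.card_biUnion_le_card_mul _ _ _ fun A hA =>
      hvB A (Multiset.mem_toFinset.1 (Finset.mem_filter.1 hA).1)
  refine (Finset.card_le_card hsub).trans ((Finset.card_union_le _ _).trans (add_le_add
    ((Finset.card_union_le _ _).trans (add_le_add hVn ((Finset.card_union_le _ _).trans
      (add_le_add ?_ ?_)))) hW))
  · exact h1.trans (Nat.mul_le_mul_right B hΔV)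
  · exact h2.trans (Nat.mul_le_mul_right B hΔf)

theorem finite_nodup_multisets {α : Type*} {s : Set α} (hs : s.Finite) :
    {m : Multiset α | m.Nodup ∧ ∀ a ∈ m, a ∈ s}.Finite := by
  refine (hs.toFinset.powerset.finite_toSet.image Finset.val).subset ?_
  rintro m ⟨hm, h⟩
  exact ⟨⟨m, hm⟩, Finset.mem_coe.2 (Finset.mem_powerset.2 fun a ha =>
    hs.mem_toFinset.2 (h a ha)), rfl⟩

/-- The ground clauses of a clause under a set of pairs `(x, s)`, where the pair `(x, s)` forbids
that `x` is an instance of `s`. -/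
def groundOf (C : Clause L ℕ) (p : Set (ℕ × L.Term ℕ)) : Set (Clause L Empty) :=
  {D | ∃ δ : ℕ → L.Term Empty, (∀ q ∈ p, ¬ ∃ τ : ℕ → L.Term Empty, δ q.1 = q.2.subst τ) ∧
    D = C.subst δ}

/-- A solvable solved constraint constrains each variable separately, so the ground clauses do not
depend on the constraints on variables outside of the clause, on the names of the
variables, and on the chosen representatives of the right-hand sides. -/
theorem ground_eq_groundOf {T : Set (L.Term ℕ)} {C : Clause L ℕ} {m : Multiset (Diseq L ℕ)}
    (hm : Constraint.Solved (.conj m)) (hT : ∀ d ∈ m, ∃ t ∈ T, RenamingEquiv d.rhs t)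
    (hsolv : (Constraint.conj m).Solvable) {r r' : ℕ → ℕ} (hr : ∀ x ∈ C.vars, r' (r x) = x) :
    ground ⟨C, .conj m⟩ = groundOf (C.subst fun x => .var (r x))
      {q | ∃ x ∈ C.vars, ∃ s, q.1 = r x ∧ q.2 ∈ T ∧ ⟨.var x, s⟩ ∈ m ∧ RenamingEquiv s q.2} := by
  classical
  ext D
  constructor
  · rintro ⟨δ, hδ, rfl⟩
    refine ⟨fun i => δ (r' i), ?_, ?_⟩
    · rintro ⟨_, t⟩ ⟨x, hx, s, rfl, -, hs, hst⟩ h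
      simp only [hr x hx] at h
      exact hδ _ hs ((hst.exists_instance_iff _).2 h)
    · rw [Clause.subst_subst]
      exact Clause.subst_congr _ fun x hx => by simp [hr x hx]
  · rintro ⟨δ, hδ, rfl⟩
    -- a solution `δ₀` takes care of the variables outside of the clause
    obtain ⟨δ₀, hδ₀⟩ := hsolv
    refine ⟨fun x => if x ∈ C.vars then δ (r x) else δ₀ x, ?_, ?_⟩
    · rintro ⟨l, s⟩ hd h
      obtain ⟨x, rfl⟩ : ∃ x, l = .var x := hm _ hd
      obtain ⟨t, ht, hst⟩ := hT _ hd
      by_cases hx : x ∈ C.vars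
      · simp only [Term.subst, hx, if_true] at h
        exact hδ (r x, t) ⟨x, hx, s, rfl, ht, hd, hst⟩ ((hst.exists_instance_iff _).1 h)
      · simp only [Term.subst, hx, if_false] at h
        exact hδ₀ _ hd h
    · rw [Clause.subst_subst]
      exact Clause.subst_congr _ fun x hx => by simp [hx]

/-- Up to variants, there are only finitely many uncondensable bounded clauses with solved bounded
constraints. -/
theorem finite_ground {F : Set (Σ n, L.Functions n)} (hF : F.Finite)
    {R : Set (L.Relations 1)} (hR : R.Finite) (n : ℕ) :
    (ground '' {c : CClause L | IsMSL c.cl ∧ BoundedClause F R n c.cl ∧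
      BoundedConstraint F n c.con ∧ c.con.Solved ∧ ∀ c', ¬ IsCondensationOf c' c}).Finite := by
  classical
  obtain ⟨T, hTf, hTr⟩ := exists_finite_representatives hF n
  obtain ⟨M, hM⟩ := exists_card_vars_le hF hR n hTf
  -- depth `n + 1` leaves room for the shallow positive literals if `n` is zero
  let 𝒜 : Set (Atom L ℕ) := (fun p : L.Relations 1 × L.Term ℕ => .pred p.1 p.2) ''
    (R ×ˢ {t | termFuncs t ⊆ F ∧ termDepth t ≤ n + 1 ∧ ∀ x ∈ termVars t, x ∈ {i | i < M}})
  have h𝒜 : 𝒜.Finite := (hR.prod (finite_terms hF (Set.finite_lt_nat M) _)).image _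
  let 𝒞 : Set (Clause L ℕ) := (fun p : Multiset (Atom L ℕ) × Multiset (Atom L ℕ) => ⟨p.1, p.2⟩) ''
    ({m | m.Nodup ∧ ∀ A ∈ m, A ∈ 𝒜} ×ˢ {m | m.Nodup ∧ ∀ A ∈ m, A ∈ 𝒜})
  have h𝒞 : 𝒞.Finite :=
    ((finite_nodup_multisets h𝒜).prod (finite_nodup_multisets h𝒜)).image _
  have hP : (𝒫 ({i : ℕ | i < M} ×ˢ T)).Finite := ((Set.finite_lt_nat M).prod hTf).finite_subsets
  refine ((Set.Finite.image2 groundOf h𝒞 hP).insert ∅).subset ?_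
  rintro _ ⟨⟨C, π⟩, ⟨hC, hb, hbc, hm, hc⟩, rfl⟩
  cases π with
  | bot => exact .inl (Set.eq_empty_of_forall_notMem fun D ⟨δ, h, _⟩ => h)
  | conj m =>
  by_cases hsolv : (Constraint.conj m).Solvable
  swap
  · exact .inl (Set.eq_empty_of_forall_notMem fun D ⟨δ, h, _⟩ => hsolv ⟨δ, h⟩)
  right
  have hT : ∀ d ∈ m, ∃ t ∈ T, RenamingEquiv d.rhs t := fun d hd =>
    hTr _ (hbc d hd).2.1 (hbc d hd).2.2
  obtain ⟨r, r', hr⟩ := exists_rename_lt _ (hM C m hC hb hm hT hc)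
  simp only [Multiset.mem_toFinset] at hr
  obtain ⟨hn1, hn2⟩ := nodup_of_no_condensation hm hc
  rw [ground_eq_groundOf hm hT hsolv fun x hx => (hr x hx).2]
  refine Set.mem_image2_of_mem ?_ ?_
  · have hmem : ∀ A, A ∈ C.ante ∨ A ∈ C.succ → ∃ S ∈ R, ∃ t, A = .pred S t ∧
        termFuncs t ⊆ F ∧ termDepth t ≤ n + 1 := by
      rintro A (hA | hA)
      · obtain ⟨V, -, hV⟩ := hb.ante
        obtain ⟨S, hS, t, rfl, ⟨x, rfl⟩ | ht⟩ := hV A hA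
        · exact ⟨S, hS, _, rfl, by simp [termFuncs], by simp [termDepth]⟩
        · exact ⟨S, hS, t, rfl, ht.2.1, ht.2.2.trans (Nat.le_succ n)⟩
      · obtain ⟨P, hP, t, rfl, hF⟩ := hb.succ A hA
        obtain ⟨P', t', heq, ht⟩ := hC.shallow _ hA
        cases heq
        exact ⟨P, hP, t, rfl, hF, (show termDepth t ≤ 1 from ht).trans (by omega)⟩
    have hleft : ∀ A, A ∈ C.ante ∨ A ∈ C.succ →
        (A.subst fun x => (.var (r x) : L.Term ℕ)).subst (fun x => .var (r' x)) = A := by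
      intro A hA
      rw [Atom.subst_subst, Atom.subst_eq_self]
      exact fun x hx => by simp [(hr x (Clause.mem_vars.2 ⟨A, hA, hx⟩)).2]
    have h𝒜r : ∀ A, A ∈ C.ante ∨ A ∈ C.succ → (A.subst fun x => .var (r x)) ∈ 𝒜 := by
      intro A hA
      obtain ⟨S, hS, t, rfl, hf, hd⟩ := hmem A hA
      have hv : ∀ x ∈ termVars t, ∃ y, (.var (r x) : L.Term ℕ) = .var y := fun x _ => ⟨_, rfl⟩
      refine ⟨(S, t.subst fun x => .var (r x)), ⟨hS, ?_, ?_, fun x hx => ?_⟩, rfl⟩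
      · rwa [termFuncs_rename _ hv]
      · rwa [termDepth_rename _ hv]
      · simp only [termVars_rename, Multiset.mem_map] at hx
        obtain ⟨y, hy, rfl⟩ := hx
        exact (hr y (Clause.mem_vars.2 ⟨_, hA, hy⟩)).1
    have hnod : ∀ s : Multiset (Atom L ℕ), s.Nodup → (∀ A ∈ s, A ∈ C.ante ∨ A ∈ C.succ) →
        (s.map (Atom.subst fun x => .var (r x))) ∈
          {m : Multiset (Atom L ℕ) | m.Nodup ∧ ∀ A ∈ m, A ∈ 𝒜} := by
      refine fun s hs hsC => ⟨hs.map_on fun A hA A' hA' heq => ?_, fun B hB => ?_⟩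
      · rw [← hleft A (hsC A hA), heq, hleft A' (hsC A' hA')]
      · obtain ⟨A, hA, rfl⟩ := Multiset.mem_map.1 hB
        exact h𝒜r A (hsC A hA)
    exact ⟨(_, _), ⟨hnod _ hn1 fun _ => .inl, hnod _ hn2 fun _ => .inr⟩, rfl⟩
  · rintro ⟨_, t⟩ ⟨x, hx, s, rfl, ht, -⟩
    exact ⟨(hr x hx).1, ht⟩

end Finiteness

/-! ### Most general unifiers with a shallow linear term -/

section Unifiers

variable {L : FirstOrder.Language.{u, v}} {α : Type}

/-- If a shallow linear term `s` unifies with `t`, and is not more complex than `t` in the sense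
that `t` is complex or `s` is a variable, then `t` is an instance of `s`. -/
theorem exists_match {s t : L.Term α} {σ : α → L.Term ℕ} (hs : IsShallow s) (hl : IsLinearTerm s)
    (h : s.subst σ = t.subst σ) (hst : IsComplex t ∨ ∃ y, s = .var y) :
    ∃ μ : α → L.Term α, s.subst μ = t ∧ ∀ x ∈ termVars s, σ x = (μ x).subst σ ∧
      (∀ y ∈ termVars (μ x), y ∈ termVars t) ∧ termFuncs (μ x) ⊆ termFuncs t ∧
      termDepth (μ x) ≤ termDepth t := by
  obtain ⟨y, rfl⟩ | ⟨n, f, y, rfl⟩ := hs.cases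
  · refine ⟨fun _ => t, rfl, fun x hx => ?_⟩
    obtain rfl : x = y := (mem_termVars_var (L := L)).1 hx
    exact ⟨h, fun _ => id, subset_rfl, le_rfl⟩
  · have hinj := injective_of_isLinearTerm_flat hl
    cases t with
    | var z =>
      obtain hc | ⟨y, hy⟩ := hst
      · exact absurd rfl (hc z)
      · cases hy
    | func g ts =>
      simp only [Term.subst, Term.func.injEq] at h
      obtain ⟨rfl, h⟩ := h
      rw [heq_eq_eq, heq_eq_eq] at h
      obtain ⟨rfl, h⟩ := h
      refine ⟨Function.extend y ts Term.var, ?_, fun x hx => ?_⟩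
      · simp only [Term.subst, Term.func.injEq, heq_eq_eq, true_and]
        funext i
        rw [hinj.extend_apply]
      · obtain ⟨i, rfl⟩ := mem_termVars_flat.1 hx
        rw [hinj.extend_apply]
        exact ⟨congrFun h i, fun z hz => mem_termVars_func.2 ⟨i, hz⟩, termFuncs_arg_subset f ts i,
          (termDepth_arg_lt f ts i).le⟩

/-- The shape of a most general unifier of two variable disjoint terms of which the first one is
shallow, linear and matches the second one: it renames the variables that do not occur in the first
term, and maps the variables of the first term to renamed subterms of the second one. -/
theorem IsMGU.exists_rename_match [Countable α] {σ : α → L.Term ℕ} {P Q : L.Relations 1}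
    {s t : L.Term α} (hσ : IsMGU σ (.pred P s) (.pred Q t)) (hs : IsShallow s)
    (hl : IsLinearTerm s) (hdisj : ∀ x ∈ termVars s, x ∉ termVars t)
    (hst : IsComplex t ∨ ∃ y, s = .var y) :
    ∃ (g : α → ℕ) (μ : α → L.Term α), Set.InjOn g {x | x ∉ termVars s} ∧
      (∀ x, x ∉ termVars s → σ x = .var (g x)) ∧ s.subst μ = t ∧
      ∀ x ∈ termVars s, σ x = (μ x).subst (fun y => .var (g y)) ∧
        (∀ y ∈ termVars (μ x), y ∈ termVars t) ∧ termFuncs (μ x) ⊆ termFuncs t ∧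
        termDepth (μ x) ≤ termDepth t := by
  classical
  obtain ⟨e, he⟩ := Countable.exists_injective_nat α
  obtain ⟨hu, hmg⟩ := hσ
  simp only [Atom.subst, Atom.pred.injEq] at hu hmg
  obtain ⟨rfl, hu⟩ := hu
  obtain ⟨μ, hμ, hμs⟩ := exists_match hs hl hu hst
  -- comparing with the unifier that is injective outside of `s` shows that `σ` is injective there
  let τ : α → L.Term ℕ := fun x =>
    if x ∈ termVars s then (μ x).subst fun y => .var (e y) else .var (e x)
  obtain ⟨ρ, hρ⟩ := hmg τ ⟨rfl, by
    rw [subst_congr s (τ := fun x => (μ x).subst fun y => .var (e y)) fun x hx => if_pos hx,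
      ← subst_subst, hμ]
    exact (subst_congr t fun x hx => if_neg fun hxs => hdisj x hxs hx).symm⟩
  have hv : ∀ x, ∃ y, x ∉ termVars s → σ x = .var y ∧ ρ y = .var (e x) := fun x => by
    by_cases hx : x ∈ termVars s
    · exact ⟨0, fun h => absurd hx h⟩
    · have h : Term.var (e x) = (σ x).subst ρ := by
        rw [← hρ x]
        exact (if_neg hx).symm
      cases hσx : σ x with
      | var y =>
        rw [hσx] at h
        exact ⟨y, fun _ => ⟨rfl, h.symm⟩⟩
      | func f ts =>
        rw [hσx] at h
        cases h
  choose g hg using hv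
  refine ⟨g, μ, fun x hx y hy hxy => he ?_, fun x hx => (hg x hx).1, hμ, fun x hx => ?_⟩
  · have h1 := (hg x hx).2
    rw [hxy, (hg y hy).2] at h1
    exact (Term.var.inj h1).symm
  · obtain ⟨h1, h2, h3⟩ := hμs x hx
    refine ⟨?_, h2, h3⟩
    rw [h1]
    exact subst_congr _ fun y hy => (hg y fun hys => hdisj y hys (h2 y hy)).1

end Unifiers

/-! ### Conclusions before unification -/

section Closure

variable {L : FirstOrder.Language.{u, v}} {α : Type}

theorem Atom.vars_subst {β : Type} (σ : α → L.Term β) (A : Atom L α) :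
    (A.subst σ).vars = A.vars.bind fun x => termVars (σ x) := by
  cases A <;> simp [Atom.subst, Atom.vars, termVars_subst]

theorem termDepth_var_le_one (x : α) : termDepth (.var x : L.Term α) ≤ 1 := by simp [termDepth]

/-- Conclusions of inferences whose unifier matches a shallow linear term `s` with a term `t` over
the reservoir `V` are bounded MSL clauses. The antecedent `Γ` and the succedent `Δ` are those of the
conclusion before the unifier is applied. -/
theorem bounded_conclusion [Countable α] {F : Set (Σ n, L.Functions n)} {R : Set (L.Relations 1)}
    {n : ℕ} {σ : α → L.Term ℕ} {P Q : L.Relations 1} {s t : L.Term α}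
    (hσ : IsMGU σ (.pred P s) (.pred Q t)) (hs : IsShallow s) (hl : IsLinearTerm s)
    (hdisj : ∀ x ∈ termVars s, x ∉ termVars t) (hst : IsComplex t ∨ ∃ y, s = .var y)
    {V : Finset α} (hVn : V.card ≤ n) (htV : ∀ x ∈ termVars t, x ∈ V) (htF : termFuncs t ⊆ F)
    (htn : termDepth t ≤ n) {Γ Δ : Multiset (Atom L α)}
    (hΓ : ∀ A ∈ Γ, ∃ S ∈ R, ∃ u, A = .pred S u ∧ ((∃ x, u = .var x) ∨
      (∀ x ∈ termVars u, x ∈ V ∧ x ∉ termVars s) ∧ termFuncs u ⊆ F ∧ termDepth u ≤ n))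
    (hΔ : ∀ A ∈ Δ, ∃ S ∈ R, ∃ u, A = .pred S u ∧ termFuncs u ⊆ F ∧ IsShallow u ∧
      ((∀ x ∈ termVars u, x ∉ termVars s) ∨ u = s ∧ (∃ x, s = .var x) ∧ IsShallow t ∧
        IsLinearTerm t ∧ ∀ x ∈ Δ.bind Atom.vars, x ∉ termVars t))
    (hnodup : (Δ.bind Atom.vars).Nodup) :
    IsMSL ⟨Γ.map (Atom.subst σ), Δ.map (Atom.subst σ)⟩ ∧
      BoundedClause F R n ⟨Γ.map (Atom.subst σ), Δ.map (Atom.subst σ)⟩ := by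
  classical
  obtain ⟨g, μ, hg, hσg, hμt, hσμ⟩ := hσ.exists_rename_match hs hl hdisj hst
  have hren : ∀ u : L.Term α, (∀ x ∈ termVars u, x ∉ termVars s) →
      u.subst σ = u.subst fun x => .var (g x) := fun u hu =>
    subst_congr u fun x hx => hσg x (hu x hx)
  have hrt : s.subst σ = t.subst fun x => .var (g x) := by
    rw [← hren t fun x hx hxs => hdisj x hxs hx]
    have := hσ.1
    simp only [Atom.subst, Atom.pred.injEq] at this
    exact this.2
  have hF : ∀ u : L.Term α, termFuncs (u.subst fun x => (.var (g x) : L.Term ℕ)) = termFuncs u :=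
    fun u => termFuncs_rename u fun x _ => ⟨_, rfl⟩
  have hD : ∀ u : L.Term α, termDepth (u.subst fun x => (.var (g x) : L.Term ℕ)) = termDepth u :=
    fun u => termDepth_rename u fun x _ => ⟨_, rfl⟩
  have hlin : ∀ u : L.Term α, IsLinearTerm u → (∀ x ∈ termVars u, x ∉ termVars s) →
      (termVars (u.subst fun x => (.var (g x) : L.Term ℕ))).Nodup := fun u hu hus => by
    rw [termVars_rename]
    exact Multiset.Nodup.map_on (fun x hx y hy h => hg (hus x hx) (hus y hy) h) hu
  have hbr : ∀ u : L.Term α, (∀ x ∈ termVars u, x ∈ V) → termFuncs u ⊆ F → termDepth u ≤ n →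
      (∀ x ∈ termVars (u.subst fun x => (.var (g x) : L.Term ℕ)), x ∈ V.image g) ∧
      termFuncs (u.subst fun x => (.var (g x) : L.Term ℕ)) ⊆ F ∧
      termDepth (u.subst fun x => (.var (g x) : L.Term ℕ)) ≤ n := fun u h1 h2 h3 => by
    rw [hF, hD]
    refine ⟨fun x hx => ?_, h2, h3⟩
    rw [termVars_rename, Multiset.mem_map] at hx
    obtain ⟨y, hy, rfl⟩ := hx
    exact Finset.mem_image_of_mem _ (h1 y hy)
  have hΓσ : ∀ A ∈ Γ.map (Atom.subst σ), ∃ S ∈ R, ∃ u, A = .pred S u ∧ ((∃ x, u = .var x) ∨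
      (∀ x ∈ termVars u, x ∈ V.image g) ∧ termFuncs u ⊆ F ∧ termDepth u ≤ n) := by
    intro A' hA'
    obtain ⟨A, hA, rfl⟩ := Multiset.mem_map.1 hA'
    obtain ⟨S, hS, u, rfl, ⟨x, rfl⟩ | ⟨huV, huF, hun⟩⟩ := hΓ A hA
    · refine ⟨S, hS, _, rfl, ?_⟩
      by_cases hx : x ∈ termVars s
      · obtain ⟨h1, h2, h3, h4⟩ := hσμ x hx
        right
        simp only [Term.subst, h1]
        exact hbr _ (fun y hy => htV y (h2 y hy)) (h3.trans htF) (h4.trans htn)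
      · exact .inl ⟨_, hσg x hx⟩
    · refine ⟨S, hS, _, rfl, .inr ?_⟩
      rw [hren u fun x hx => (huV x hx).2]
      exact hbr u (fun x hx => (huV x hx).1) huF hun
  have hΔσ : ∀ A ∈ Δ.map (Atom.subst σ), ∃ S ∈ R, ∃ u, A = .pred S u ∧ termFuncs u ⊆ F ∧
      IsShallow u := by
    intro A' hA'
    obtain ⟨A, hA, rfl⟩ := Multiset.mem_map.1 hA'
    obtain ⟨S, hS, u, rfl, huF, hu, hus | ⟨rfl, -, ht, -⟩⟩ := hΔ A hA
    · refine ⟨S, hS, _, rfl, ?_⟩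
      rw [IsShallow, hren u hus, hF, hD]
      exact ⟨huF, hu⟩
    · refine ⟨S, hS, _, rfl, ?_⟩
      rw [IsShallow, hrt, hF, hD]
      exact ⟨htF, ht⟩
  -- only one variable of `s` can occur in the succedent, and then `s` is this variable
  have hsΔ : ∀ x ∈ Δ.bind Atom.vars, x ∈ termVars s → s = .var x ∧ IsLinearTerm t ∧
      ∀ x ∈ Δ.bind Atom.vars, x ∉ termVars t := by
    intro x hx hxs
    obtain ⟨A, hA, hxA⟩ := Multiset.mem_bind.1 hx
    obtain ⟨S, hS, u, rfl, -, -, hus | ⟨rfl, ⟨y, rfl⟩, -, hlt, hdt⟩⟩ := hΔ A hA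
    · exact absurd hxs (hus x hxA)
    · obtain rfl : x = y := (mem_termVars_var (L := L)).1 hxs
      exact ⟨rfl, hlt, hdt⟩
  have hvt : ∀ x, s = .var x → termVars (σ x) = (termVars t).map g := by
    rintro x rfl
    rw [← termVars_rename, ← hrt]
    rfl
  have hvg : ∀ x, x ∉ termVars s → termVars (σ x) = {g x} := fun x hx => by
    rw [hσg x hx]
    rfl
  have hts : ∀ x ∈ termVars t, x ∉ termVars s := fun x hx hxs => hdisj x hxs hx
  have key : ∀ x ∈ Δ.bind Atom.vars, ∀ y ∈ Δ.bind Atom.vars, x ∈ termVars s → y ∉ termVars s →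
      Disjoint (termVars (σ x)) (termVars (σ y)) := by
    intro x hx y hy hxs hys
    obtain ⟨rfl, -, hdt⟩ := hsΔ x hx hxs
    rw [hvt x rfl, hvg y hys, Multiset.disjoint_right]
    intro z hz hz'
    obtain rfl := Multiset.mem_singleton.1 hz
    obtain ⟨w, hw, hwy⟩ := Multiset.mem_map.1 hz'
    exact hdt y hy (hg (hts w hw) hys hwy ▸ hw)
  refine ⟨⟨fun A hA => ?_, ?_, .inl fun A hA hE => ?_⟩,
    ⟨⟨V.image g, Finset.card_image_le.trans hVn, hΓσ⟩, fun A hA => ?_⟩⟩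
  · obtain ⟨S, -, u, rfl, -, hu⟩ := hΔσ A hA
    exact ⟨S, u, rfl, hu⟩
  · have : (Clause.mk (Γ.map (Atom.subst σ)) (Δ.map (Atom.subst σ))).succVars =
        (Δ.bind Atom.vars).bind fun x => termVars (σ x) := by
      simp only [Clause.succVars, Multiset.bind_map, Multiset.bind_assoc, Atom.vars_subst]
    rw [this, Multiset.nodup_bind]
    refine ⟨fun x hx => ?_, Multiset.Nodup.pairwise (fun x hx y hy hxy => ?_) hnodup⟩
    · by_cases hxs : x ∈ termVars s
      · obtain ⟨hsx, hlt, -⟩ := hsΔ x hx hxs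
        rw [hvt x hsx, ← termVars_rename]
        exact hlin t hlt hts
      · rw [hvg x hxs]
        exact Multiset.nodup_singleton _
    · by_cases hxs : x ∈ termVars s
      · by_cases hys : y ∈ termVars s
        · obtain ⟨rfl, -⟩ := hsΔ x hx hxs
          exact absurd ((mem_termVars_var (L := L)).1 hys).symm hxy
        · exact key x hx y hy hxs hys
      · by_cases hys : y ∈ termVars s
        · exact (key y hy x hx hys hxs).symm
        · rw [Function.onFun, hvg x hxs, hvg y hys, Multiset.disjoint_singleton]
          exact fun h => hxy (hg hys hxs (Multiset.mem_singleton.1 h)).symm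
  · obtain ⟨S, -, u, rfl, -⟩ := hΓσ A hA
    obtain ⟨_, _, h⟩ := hE
    cases h
  · obtain ⟨S, hS, u, rfl, hu, -⟩ := hΔσ A hA
    exact ⟨S, hS, u, rfl, hu⟩

end Closure

/-! ### Bounded clauses are closed under inferences -/

section Inferences

variable {L : FirstOrder.Language.{u, v}}

/-- In a clause without selected literals, all negative literals are of the form `S(x)` where `x`
occurs in the succedent, but not as the argument of a positive literal. -/
theorem NoneSelected.ante {C : Clause L ℕ} (h : NoneSelected C) {A : Atom L ℕ}
    (hA : A ∈ C.ante) : ∃ S x, A = .pred S (.var x) ∧ x ∈ C.succVars ∧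
      ∀ P, Atom.pred P (.var x) ∉ C.succ := by
  have hvar : ∀ B ∈ C.ante, ∃ S x, B = .pred S (.var x) := fun B hB => by
    obtain ⟨S, t⟩ | ⟨s, t⟩ := B
    · by_cases hc : IsComplex t
      · exact absurd ⟨hB, .inr ⟨S, t, rfl, .inl hc⟩⟩ (h _)
      · obtain ⟨x, rfl⟩ := not_isComplex.1 hc
        exact ⟨S, x, rfl⟩
    · exact absurd ⟨hB, .inl ⟨s, t, rfl⟩⟩ (h _)
  have hmem : ∀ S x, Atom.pred S (.var x) ∈ C.ante → x ∈ C.succVars := fun S x hx => by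
    by_contra hxs
    exact h _ ⟨hx, .inr ⟨S, _, rfl, .inr (.inl ⟨hvar, x, rfl, hxs⟩)⟩⟩
  obtain ⟨S, x, rfl⟩ := hvar A hA
  refine ⟨S, x, rfl, hmem S x hA, fun P hP => h _ ⟨hA, .inr ⟨S, _, rfl, .inr (.inr ⟨?_, P, hP⟩)⟩⟩⟩
  intro B hB
  obtain ⟨S', y, rfl⟩ := hvar B hB
  exact ⟨S', y, rfl, hmem S' y hB⟩

/-- A negative literal with a variable argument is never maximal if nothing is selected: the
variable occurs properly below the argument of a positive literal. -/
theorem NoneSelected.not_isMaximal {lt : Atom L Empty → Atom L Empty → Prop}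
    (hlt : AdmissibleOrder lt) {B : Atom L ℕ} {Γ Δ : Multiset (Atom L ℕ)}
    (hC : IsMSL ⟨B ::ₘ Γ, Δ⟩) (h : NoneSelected ⟨B ::ₘ Γ, Δ⟩) {σ : ℕ → L.Term ℕ}
    {π : Constraint L ℕ} :
    ¬ IsMaximal lt (.neg (B.subst σ)) (Clause.subst σ ⟨Γ, Δ⟩) π := by
  rintro ⟨δ, -, hmax⟩
  obtain ⟨Q, x, rfl, hx, hxP⟩ := h.ante (Multiset.mem_cons_self B Γ)
  obtain ⟨D, hD, hxD⟩ := Clause.mem_succVars.1 hx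
  obtain ⟨P, u, rfl, -⟩ := hC.shallow D hD
  have hu : IsComplex u := by
    rintro y rfl
    obtain rfl : x = y := (mem_termVars_var (L := L)).1 hxD
    exact hxP P hD
  have hmem : Literal.pos (Atom.subst σ (.pred P u)) ∈ (Clause.subst σ ⟨Γ, Δ⟩).literals :=
    Multiset.mem_add.2 (.inr (Multiset.mem_map_of_mem _ (Multiset.mem_map_of_mem _ hD)))
  obtain hlit | heq := hmax _ hmem
  · refine hlt.subterm P Q _ _ ?_ hlit
    rw [subst_subst, subst_subst]
    exact properSubterm_subst_of_mem_termVars (σ := fun x => (σ x).subst δ) hu hxD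
  · cases heq

/-- MSL clauses with bounded constraints that are bounded, or that contain an equation and hence
take part in no inference. -/
def BoundedInput (F : Set (Σ n, L.Functions n)) (R : Set (L.Relations 1)) (n : ℕ)
    (c : CClause L) : Prop :=
  IsMSL c.cl ∧ BoundedConstraint F n c.con ∧
    ((∃ A ∈ c.cl.ante, A.IsEqn) ∨ BoundedClause F R n c.cl)

/-- Bounded MSL clauses with bounded and solved constraints. -/
def BoundedResult (F : Set (Σ n, L.Functions n)) (R : Set (L.Relations 1)) (n : ℕ)
    (c : CClause L) : Prop :=
  IsMSL c.cl ∧ BoundedClause F R n c.cl ∧ BoundedConstraint F n c.con ∧ c.con.Solved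

theorem BoundedResult.boundedInput {F : Set (Σ n, L.Functions n)} {R : Set (L.Relations 1)} {n : ℕ}
    {c : CClause L} (h : BoundedResult F R n c) : BoundedInput F R n c :=
  ⟨h.1, h.2.2.1, .inr h.2.1⟩

theorem BoundedConstraint.subst {F : Set (Σ n, L.Functions n)} {n : ℕ} {π : Constraint L ℕ}
    (h : BoundedConstraint F n π) (σ : ℕ → L.Term ℕ) : BoundedConstraint F n (π.subst σ) := by
  cases π with
  | bot => trivial
  | conj m =>
    intro d hd
    obtain ⟨e, he, rfl⟩ := Multiset.mem_map.1 hd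
    exact h e he

theorem BoundedConstraint.and {F : Set (Σ n, L.Functions n)} {n : ℕ} {π π' : Constraint L ℕ}
    (h : BoundedConstraint F n π) (h' : BoundedConstraint F n π') :
    BoundedConstraint F n (π.and π') := by
  cases π <;> cases π' <;> try trivial
  exact fun d hd => (Multiset.mem_add.1 hd).elim (h d) (h' d)

theorem BoundedConstraint.normalForm_solved {F : Set (Σ n, L.Functions n)} {n : ℕ}
    {π π' : Constraint L ℕ} (h : BoundedConstraint F n π) (hnf : π.NormalFormOf π') :
    BoundedConstraint F n π' ∧ π'.Solved :=
  ⟨h.normalForm hnf, hnf.2.solved (h.normalForm hnf).isStraightConstraint⟩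

theorem card_termVars_le_of_isShallow {F : Set (Σ n, L.Functions n)} {n : ℕ}
    (hFn : ∀ p ∈ F, p.1 ≤ n) (hn : 1 ≤ n) {α : Type} {t : L.Term α} (ht : IsShallow t)
    (htF : termFuncs t ⊆ F) : (termVars t).card ≤ n := by
  obtain ⟨x, rfl⟩ | ⟨k, f, y, rfl⟩ := ht.cases
  · simpa [termVars] using hn
  · simpa [termVars_flat] using hFn ⟨k, f⟩ (htF (Set.mem_insert _ _))

theorem BoundedInput.factoring {lt : Atom L Empty → Atom L Empty → Prop}
    {F : Set (Σ n, L.Functions n)} {R : Set (L.Relations 1)} {n : ℕ} (hFn : ∀ p ∈ F, p.1 ≤ n)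
    (hn : 1 ≤ n) {c r : CClause L} (hc : BoundedInput F R n c) (h : Factoring lt c r) :
    BoundedResult F R n r := by
  classical
  obtain ⟨Γ, Δ, A, B, π, π', σ, hmgu, hsel, hmax, hnorm, hsolv⟩ := h
  obtain ⟨hC, hπ, hb⟩ := hc
  have hb : BoundedClause F R n ⟨Γ, A ::ₘ B ::ₘ Δ⟩ := hb.resolve_left fun ⟨D, hD, hE⟩ =>
    hsel D ⟨hD, .inl hE⟩
  obtain ⟨hπ'1, hπ'2⟩ := (hπ.subst σ).normalForm_solved hnorm
  -- by symmetry, the argument of `A` may be assumed to match the argument of `B`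
  suffices hsuff : ∀ A' B', A ::ₘ B ::ₘ Δ = A' ::ₘ B' ::ₘ Δ → IsMGU σ A' B' →
      (∀ P s Q t, A' = .pred P s → B' = .pred Q t → IsComplex t ∨ ∃ y, s = .var y) →
      IsMSL (Clause.subst σ ⟨Γ, B' ::ₘ Δ⟩) ∧ BoundedClause F R n (Clause.subst σ ⟨Γ, B' ::ₘ Δ⟩) by
    have hAB : Clause.subst σ ⟨Γ, A ::ₘ Δ⟩ = Clause.subst σ ⟨Γ, B ::ₘ Δ⟩ := by
      simp [Clause.subst, hmgu.1]
    have hres : IsMSL (Clause.subst σ ⟨Γ, A ::ₘ Δ⟩) ∧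
        BoundedClause F R n (Clause.subst σ ⟨Γ, A ::ₘ Δ⟩) := by
      by_cases hor : ∀ P s Q t, A = .pred P s → B = .pred Q t → IsComplex t ∨ ∃ y, s = .var y
      · rw [hAB]
        exact hsuff A B rfl hmgu hor
      · refine hsuff B A (Multiset.cons_swap _ _ _) ⟨hmgu.1.symm, fun τ h => hmgu.2 τ h.symm⟩ ?_
        rintro P s Q t rfl rfl
        by_contra hcon
        refine hor fun P' t' Q' s' h1 h2 => ?_
        cases h1
        cases h2
        rw [not_or, not_isComplex] at hcon
        exact .inr hcon.1
    exact ⟨hres.1, hres.2, hπ'1, hπ'2⟩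
  intro A' B' hAB hmgu' hor
  rw [hAB] at hC hb hsel
  have hsucc : ∀ D ∈ A' ::ₘ B' ::ₘ Δ, ∃ P ∈ R, ∃ t, D = .pred P t ∧ termFuncs t ⊆ F ∧
      IsShallow t := fun D hD => by
    obtain ⟨P, hP, t, rfl, hF⟩ := hb.succ D hD
    obtain ⟨_, _, heq, ht⟩ := hC.shallow _ hD
    cases heq
    exact ⟨P, hP, t, rfl, hF, ht⟩
  obtain ⟨P, hP, s, rfl, hsF, hs⟩ := hsucc A' (by simp)
  obtain ⟨Q, hQ, t, rfl, htF, ht⟩ := hsucc B' (by simp)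
  have hlin : (termVars s + (termVars t + Δ.bind Atom.vars)).Nodup := by
    simpa [Clause.succVars, Atom.vars] using hC.linear
  obtain ⟨hls, hrest, hdisj⟩ := Multiset.nodup_add.1 hlin
  rw [Multiset.disjoint_left] at hdisj
  refine bounded_conclusion (V := (termVars t).toFinset) hmgu' hs hls
    (fun x hx hxt => hdisj hx (Multiset.mem_add.2 (.inl hxt))) (hor P s Q t rfl rfl)
    ((Multiset.toFinset_card_le _).trans (card_termVars_le_of_isShallow hFn hn ht htF))
    (fun x hx => Multiset.mem_toFinset.2 hx) htF (le_trans ht hn) (fun D hD => ?_)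
    (fun D hD => ?_) (by simpa [Atom.vars] using hrest)
  · obtain ⟨V, -, hV⟩ := hb.ante
    obtain ⟨S, hS, u, rfl, -⟩ := hV D hD
    obtain ⟨_, x, heq, -⟩ := hsel.ante hD
    cases heq
    exact ⟨S, hS, _, rfl, .inl ⟨x, rfl⟩⟩
  · obtain ⟨S, hS, u, rfl, huF, hu⟩ := hsucc D (Multiset.mem_cons_of_mem hD)
    refine ⟨S, hS, u, rfl, huF, hu, .inl fun x hx hxs => hdisj hxs ?_⟩
    obtain heq | hD := Multiset.mem_cons.1 hD
    · cases heq
      exact Multiset.mem_add.2 (.inl hx)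
    · exact Multiset.mem_add.2 (.inr (Multiset.mem_bind.2 ⟨_, hD, hx⟩))

theorem BoundedInput.resolution {lt : Atom L Empty → Atom L Empty → Prop}
    (hlt : AdmissibleOrder lt) {F : Set (Σ n, L.Functions n)} {R : Set (L.Relations 1)} {n : ℕ}
    (hFn : ∀ p ∈ F, p.1 ≤ n) (hn : 1 ≤ n) {c₁ c₂ r : CClause L} (hc₁ : BoundedInput F R n c₁)
    (hc₂ : BoundedInput F R n c₂) (h : Resolution lt c₁ c₂ r) : BoundedResult F R n r := by
  classical
  obtain ⟨Γ₁, Δ₁, Γ₂, Δ₂, A, B, π₁, π₂, π, σ, σ₁, σ₂, hσ₁, hσ₂, hmgu, hnorm, hsolv, hmax, hsel, hB⟩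
    := h
  obtain ⟨hC₁, hπ₁, hb₁⟩ := hc₁
  obtain ⟨hC₂, hπ₂, hb₂⟩ := hc₂
  obtain rfl : σ₁ = fun x => σ (.inl x) := funext hσ₁
  obtain rfl : σ₂ = fun x => σ (.inr x) := funext hσ₂
  obtain ⟨hπ1, hπ2⟩ := ((hπ₁.subst _).and (hπ₂.subst _)).normalForm_solved hnorm
  have hb₁ : BoundedClause F R n ⟨Γ₁, A ::ₘ Δ₁⟩ := hb₁.resolve_left fun ⟨D, hD, hE⟩ =>
    hsel D ⟨hD, .inl hE⟩
  have hB : Selected ⟨B ::ₘ Γ₂, Δ₂⟩ B := hB.resolve_right fun ⟨h1, h2⟩ =>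
    h1.not_isMaximal hlt hC₂ h2
  have hsucc : ∀ C : Clause L ℕ, IsMSL C → BoundedClause F R n C → ∀ D ∈ C.succ,
      ∃ P ∈ R, ∃ t, D = .pred P t ∧ termFuncs t ⊆ F ∧ IsShallow t := fun C hC hb D hD => by
    obtain ⟨P, hP, t, rfl, hF⟩ := hb.succ D hD
    obtain ⟨_, _, heq, ht⟩ := hC.shallow _ hD
    cases heq
    exact ⟨P, hP, t, rfl, hF, ht⟩
  obtain ⟨P, hP, s, rfl, hsF, hs⟩ := hsucc _ hC₁ hb₁ A (Multiset.mem_cons_self _ _)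
  obtain ⟨Q, t, rfl⟩ : ∃ Q t, B = .pred Q t := by
    cases B with
    | pred Q t => exact ⟨Q, t, rfl⟩
    | eqn t t' => cases hmgu.1
  -- a clause with an equation consists of this equation only
  have hb₂ : BoundedClause F R n ⟨.pred Q t ::ₘ Γ₂, Δ₂⟩ := hb₂.resolve_left fun ⟨D, hD, hE⟩ => by
    obtain hno | ⟨u, u', heq, -⟩ := hC₂.neg_eqn
    · exact hno D hD hE
    · have : Atom.pred Q t ∈ ({.eqn u u'} : Multiset (Atom L ℕ)) :=
        heq ▸ Multiset.mem_cons_self _ _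
      cases Multiset.mem_singleton.1 this
  obtain ⟨V₂, hV₂n, hV₂⟩ := hb₂.ante
  -- the conclusion before the unifier is applied, over the disjoint union of the variables
  let lift₁ : Atom L ℕ → Atom L (ℕ ⊕ ℕ) := Atom.subst fun x => .var (.inl x)
  let lift₂ : Atom L ℕ → Atom L (ℕ ⊕ ℕ) := Atom.subst fun x => .var (.inr x)
  let s' : L.Term (ℕ ⊕ ℕ) := s.subst fun x => .var (.inl x)
  let t' : L.Term (ℕ ⊕ ℕ) := t.subst fun x => .var (.inr x)
  have hcomp : ∀ Φ₁ Φ₂ : Multiset (Atom L ℕ),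
      Φ₁.map (Atom.subst fun x => σ (.inl x)) + Φ₂.map (Atom.subst fun x => σ (.inr x)) =
        (Φ₁.map lift₁ + Φ₂.map lift₂).map (Atom.subst σ) := fun Φ₁ Φ₂ => by
    simp [lift₁, lift₂, Function.comp_def, Atom.subst_subst]
  have hF₁ : ∀ u : L.Term ℕ, termFuncs (u.subst fun x => (.var (.inl x) : L.Term (ℕ ⊕ ℕ))) =
      termFuncs u := fun u => termFuncs_rename u fun x _ => ⟨_, rfl⟩
  have hF₂ : ∀ u : L.Term ℕ, termFuncs (u.subst fun x => (.var (.inr x) : L.Term (ℕ ⊕ ℕ))) =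
      termFuncs u := fun u => termFuncs_rename u fun x _ => ⟨_, rfl⟩
  have hD₁ : ∀ u : L.Term ℕ, termDepth (u.subst fun x => (.var (.inl x) : L.Term (ℕ ⊕ ℕ))) =
      termDepth u := fun u => termDepth_rename u fun x _ => ⟨_, rfl⟩
  have hD₂ : ∀ u : L.Term ℕ, termDepth (u.subst fun x => (.var (.inr x) : L.Term (ℕ ⊕ ℕ))) =
      termDepth u := fun u => termDepth_rename u fun x _ => ⟨_, rfl⟩
  have hv₁ : ∀ Φ : Multiset (Atom L ℕ), (Φ.map lift₁).bind Atom.vars =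
      (Φ.bind Atom.vars).map Sum.inl := fun Φ => by
    simp [lift₁, Multiset.bind_map, Multiset.map_bind, Atom.vars_subst, termVars]
  have hv₂ : ∀ Φ : Multiset (Atom L ℕ), (Φ.map lift₂).bind Atom.vars =
      (Φ.bind Atom.vars).map Sum.inr := fun Φ => by
    simp [lift₂, Multiset.bind_map, Multiset.map_bind, Atom.vars_subst, termVars]
  obtain ⟨hls, hΔ₁, hdisj₁⟩ : (termVars s).Nodup ∧ (Δ₁.bind Atom.vars).Nodup ∧
      Disjoint (termVars s) (Δ₁.bind Atom.vars) := by
    have := hC₁.linear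
    simpa only [Clause.succVars, Multiset.cons_bind, Atom.vars, Multiset.nodup_add] using this
  rw [Multiset.disjoint_left] at hdisj₁
  have hnodup : ((Δ₁.map lift₁ + Δ₂.map lift₂).bind Atom.vars).Nodup := by
    rw [Multiset.add_bind, hv₁, hv₂, Multiset.nodup_add]
    refine ⟨hΔ₁.map Sum.inl_injective, Multiset.Nodup.map Sum.inr_injective hC₂.linear, ?_⟩
    rw [Multiset.disjoint_left]
    intro x hx hx'
    obtain ⟨y, -, rfl⟩ := Multiset.mem_map.1 hx
    obtain ⟨z, -, h⟩ := Multiset.mem_map.1 hx'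
    cases h
  have hmem₁ : ∀ {u : L.Term ℕ} {x : ℕ ⊕ ℕ},
      x ∈ termVars (u.subst fun x => (.var (.inl x) : L.Term (ℕ ⊕ ℕ))) ↔
        ∃ y ∈ termVars u, .inl y = x := by
    simp [termVars_rename]
  have hmem₂ : ∀ {u : L.Term ℕ} {x : ℕ ⊕ ℕ},
      x ∈ termVars (u.subst fun x => (.var (.inr x) : L.Term (ℕ ⊕ ℕ))) ↔
        ∃ y ∈ termVars u, .inr y = x := by
    simp [termVars_rename]
  have hdisj : ∀ x ∈ termVars s', x ∉ termVars t' := fun x hx hx' => by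
    obtain ⟨y, -, rfl⟩ := hmem₁.1 hx
    obtain ⟨z, -, h⟩ := hmem₂.1 hx'
    cases h
  have hs' : IsShallow s' := (hD₁ s).le.trans hs
  have hls' : IsLinearTerm s' := by
    rw [IsLinearTerm, termVars_rename]
    exact hls.map Sum.inl_injective
  have hΓ₁ : ∀ D ∈ Γ₁, ∃ S ∈ R, ∃ x, D = .pred S (.var x) := fun D hD => by
    obtain ⟨V, -, hV⟩ := hb₁.ante
    obtain ⟨S, hS, u, rfl, -⟩ := hV D hD
    obtain ⟨_, x, heq, -⟩ := hsel.ante hD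
    cases heq
    exact ⟨S, hS, x, rfl⟩
  have hΔ₁' : ∀ D ∈ Δ₁, ∃ S ∈ R, ∃ u, D = .pred S u ∧ termFuncs u ⊆ F ∧ IsShallow u :=
    fun D hD => hsucc _ hC₁ hb₁ D (Multiset.mem_cons_of_mem hD)
  suffices hres : IsMSL ⟨(Γ₁.map lift₁ + Γ₂.map lift₂).map (Atom.subst σ),
      (Δ₁.map lift₁ + Δ₂.map lift₂).map (Atom.subst σ)⟩ ∧
      BoundedClause F R n ⟨(Γ₁.map lift₁ + Γ₂.map lift₂).map (Atom.subst σ),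
        (Δ₁.map lift₁ + Δ₂.map lift₂).map (Atom.subst σ)⟩ by
    rw [← hcomp, ← hcomp] at hres
    exact ⟨hres.1, hres.2, hπ1, hπ2⟩
  by_cases htc : IsComplex t
  · -- the arguments of the complex term `t` replace the variables of `s`
    obtain ⟨htV, htF, htn⟩ : (∀ x ∈ termVars t, x ∈ V₂) ∧ termFuncs t ⊆ F ∧ termDepth t ≤ n := by
      obtain ⟨S, hS, u, heq, ⟨x, rfl⟩ | hu⟩ := hV₂ _ (Multiset.mem_cons_self _ _)
      · cases heq
        exact absurd rfl (htc x)
      · cases heq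
        exact hu
    refine bounded_conclusion (s := s') (t := t') (V := V₂.image Sum.inr) hmgu hs' hls' hdisj ?_
      (Finset.card_image_le.trans hV₂n) ?_ ((hF₂ t).le.trans htF) ((hD₂ t).le.trans htn) ?_ ?_
      hnodup
    · left
      cases t with
      | var x => exact absurd rfl (htc x)
      | func f ts => exact fun x h => by simp [t'] at h
    · intro x hx
      obtain ⟨y, hy, rfl⟩ := hmem₂.1 hx
      exact Finset.mem_image_of_mem _ (htV y hy)
    · intro D hD
      obtain hD | hD := Multiset.mem_add.1 hD <;> obtain ⟨D, hD', rfl⟩ := Multiset.mem_map.1 hD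
      · obtain ⟨S, hS, x, rfl⟩ := hΓ₁ D hD'
        exact ⟨S, hS, _, rfl, .inl ⟨_, rfl⟩⟩
      · obtain ⟨S, hS, u, rfl, hu⟩ := hV₂ D (Multiset.mem_cons_of_mem hD')
        refine ⟨S, hS, _, rfl, ?_⟩
        obtain ⟨x, rfl⟩ | ⟨huV, huF, hun⟩ := hu
        · exact .inl ⟨_, rfl⟩
        · refine .inr ⟨fun x hx => ?_, (hF₂ u).le.trans huF, (hD₂ u).le.trans hun⟩
          obtain ⟨y, hy, rfl⟩ := hmem₂.1 hx
          refine ⟨Finset.mem_image_of_mem _ (huV y hy), fun hx' => ?_⟩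
          obtain ⟨z, -, h⟩ := hmem₁.1 hx'
          cases h
    · intro D hD
      obtain hD | hD := Multiset.mem_add.1 hD <;> obtain ⟨D, hD', rfl⟩ := Multiset.mem_map.1 hD
      · obtain ⟨S, hS, u, rfl, huF, hu⟩ := hΔ₁' D hD'
        refine ⟨S, hS, _, rfl, (hF₁ u).le.trans huF, (hD₁ u).le.trans hu, .inl fun x hx hx' => ?_⟩
        obtain ⟨y, hy, rfl⟩ := hmem₁.1 hx
        obtain ⟨z, hz, h⟩ := hmem₁.1 hx'
        cases h
        exact hdisj₁ hz (Multiset.mem_bind.2 ⟨_, hD', hy⟩)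
      · obtain ⟨S, hS, u, rfl, huF, hu⟩ := hsucc _ hC₂ hb₂ D hD'
        refine ⟨S, hS, _, rfl, (hF₂ u).le.trans huF, (hD₂ u).le.trans hu, .inl fun x hx hx' => ?_⟩
        obtain ⟨y, hy, rfl⟩ := hmem₂.1 hx
        obtain ⟨z, hz, h⟩ := hmem₁.1 hx'
        cases h
  · -- the shallow term `s` replaces a variable of a clause with variables in its antecedent only
    obtain ⟨x, rfl⟩ := not_isComplex.1 htc
    have hsel2 : (∀ D ∈ Γ₂, ∃ S y, D = .pred S (.var y)) ∧
        ∀ D ∈ Δ₂, x ∈ D.vars → ∃ P, D = .pred P (.var x) := by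
      obtain ⟨-, ⟨_, _, h⟩ | ⟨S, u, heq, hc | ⟨hall, y, rfl, hy⟩ | ⟨hall, P', hP'⟩⟩⟩ := hB
      · cases h
      · cases heq
        exact absurd hc htc
      · cases heq
        exact ⟨fun D hD => hall D (Multiset.mem_cons_of_mem hD), fun D hD hxD =>
          absurd (Clause.mem_succVars.2 ⟨D, hD, hxD⟩) hy⟩
      · cases heq
        refine ⟨fun D hD => ?_, fun D hD hxD => ?_⟩
        · obtain ⟨S', y, rfl, -⟩ := hall D (Multiset.mem_cons_of_mem hD)
          exact ⟨S', y, rfl⟩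
        · by_contra hne
          refine Clause.disjoint_vars_of_nodup hC₂.linear hD hP' (fun h => hne ⟨P', h⟩) hxD ?_
          simp [Atom.vars, termVars]
    refine bounded_conclusion (s := t') (t := s') (V := (termVars s').toFinset)
      ⟨hmgu.1.symm, fun τ h => hmgu.2 τ h.symm⟩ (termDepth_var_le_one _) (by
        simp [t', IsLinearTerm, termVars]) (fun x hx hx' => hdisj x hx' hx) (.inr ⟨_, rfl⟩)
      ((Multiset.toFinset_card_le _).trans
        (card_termVars_le_of_isShallow hFn hn hs' ((hF₁ s).le.trans hsF)))
      (fun x hx => Multiset.mem_toFinset.2 hx) ((hF₁ s).le.trans hsF) (le_trans hs' hn) ?_ ?_ hnodup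
    · intro D hD
      obtain hD | hD := Multiset.mem_add.1 hD <;> obtain ⟨D, hD', rfl⟩ := Multiset.mem_map.1 hD
      · obtain ⟨S, hS, x, rfl⟩ := hΓ₁ D hD'
        exact ⟨S, hS, _, rfl, .inl ⟨_, rfl⟩⟩
      · obtain ⟨S, hS, u, rfl, -⟩ := hV₂ D (Multiset.mem_cons_of_mem hD')
        obtain ⟨_, y, heq⟩ := hsel2.1 _ hD'
        cases heq
        exact ⟨S, hS, _, rfl, .inl ⟨_, rfl⟩⟩
    · intro D hD
      obtain hD | hD := Multiset.mem_add.1 hD <;> obtain ⟨D, hD', rfl⟩ := Multiset.mem_map.1 hD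
      · obtain ⟨S, hS, u, rfl, huF, hu⟩ := hΔ₁' D hD'
        refine ⟨S, hS, _, rfl, (hF₁ u).le.trans huF, (hD₁ u).le.trans hu, .inl fun x hx hx' => ?_⟩
        obtain ⟨y, hy, rfl⟩ := hmem₁.1 hx
        obtain ⟨z, hz, h⟩ := hmem₂.1 hx'
        cases h
      · obtain ⟨S, hS, u, rfl, huF, hu⟩ := hsucc _ hC₂ hb₂ D hD'
        refine ⟨S, hS, _, rfl, (hF₂ u).le.trans huF, (hD₂ u).le.trans hu, ?_⟩
        by_cases hxu : x ∈ termVars u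
        · obtain ⟨_, heq⟩ := hsel2.2 _ hD' hxu
          cases heq
          refine .inr ⟨rfl, ⟨_, rfl⟩, hs', hls', fun y hy hys => ?_⟩
          obtain ⟨z, hz, rfl⟩ := hmem₁.1 hys
          rw [Multiset.add_bind, hv₁, hv₂, Multiset.mem_add, Multiset.mem_map,
            Multiset.mem_map] at hy
          obtain ⟨w, hw, h⟩ | ⟨w, -, h⟩ := hy
          · cases h
            exact hdisj₁ hz hw
          · cases h
        · refine .inl fun y hy hy' => hxu ?_
          obtain ⟨z, hz, rfl⟩ := hmem₂.1 hy
          obtain ⟨w, hw, h⟩ := hmem₂.1 hy'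
          cases h
          obtain rfl := (mem_termVars_var (L := L)).1 hw
          exact hz

end Inferences

/-! ### Condensation and redundancy -/

section Condensation

variable {L : FirstOrder.Language.{u, v}}

theorem Clause.ProperSub.trans {α : Type} {C D E : Clause L α} (h : C.ProperSub D)
    (h' : D.ProperSub E) : C.ProperSub E := by
  refine ⟨h.1.trans h'.1, h.2.1.trans h'.2.1, ?_⟩
  rintro rfl
  exact h.2.2 (Clause.ext (le_antisymm h.1 h'.1) (le_antisymm h.2.1 h'.2.1))

theorem Clause.ProperSub.card_literals_lt {α : Type} {C D : Clause L α} (h : C.ProperSub D) :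
    C.literals.card < D.literals.card := by
  simp only [Clause.literals, Multiset.card_add, Multiset.card_map]
  have h1 := Multiset.card_le_card h.1
  have h2 := Multiset.card_le_card h.2.1
  by_contra hlt
  exact h.2.2 (Clause.ext (Multiset.eq_of_le_of_card_le h.1 (by omega))
    (Multiset.eq_of_le_of_card_le h.2.1 (by omega)))

theorem Clause.ProperSub.subst {α β : Type} {C D : Clause L α} (h : C.ProperSub D)
    (σ : α → L.Term β) : (C.subst σ).ProperSub (D.subst σ) := by
  refine ⟨Multiset.map_le_map h.1, Multiset.map_le_map h.2.1, fun heq => ?_⟩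
  have := h.card_literals_lt
  have h' := congrArg (fun E => E.literals.card) heq
  simp only [Clause.literals, Clause.subst, Multiset.card_add, Multiset.card_map] at this h'
  omega

theorem Clause.ProperSub.clauseLT {lt : Atom L Empty → Atom L Empty → Prop}
    {C D : Clause L Empty} (h : C.ProperSub D) : ClauseLT lt C D := by
  obtain ⟨Z, hZ⟩ := Multiset.le_iff_exists_add.1 (add_le_add
    (Multiset.map_le_map (f := Literal.neg) h.1) (Multiset.map_le_map (f := Literal.pos) h.2.1))
  refine ⟨C.literals, 0, Z, ?_, by simp, hZ, by simp⟩
  rintro rfl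
  have hlt := h.card_literals_lt
  rw [add_zero] at hZ
  exact hlt.ne' (congrArg Multiset.card hZ)

theorem Constraint.Sub.trans {π₁ π₂ π₃ : Constraint L ℕ} (h : π₁.Sub π₂) (h' : π₂.Sub π₃) :
    π₁.Sub π₃ := by
  cases π₁ <;> cases π₂ <;> cases π₃ <;> first | trivial | exact Multiset.Subset.trans h h'

theorem Constraint.Sub.isSolution {π π' : Constraint L ℕ} (h : π'.Sub π) {δ : ℕ → L.Term Empty}
    (hδ : π.IsSolution δ) : π'.IsSolution δ := by
  cases π <;> cases π' <;> first | trivial | exact fun d hd => hδ d (h hd)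

theorem BoundedResult.condensation {F : Set (Σ n, L.Functions n)} {R : Set (L.Relations 1)} {n : ℕ}
    {c c' : CClause L} (h : BoundedResult F R n c) (hc : IsCondensationOf c' c) :
    BoundedResult F R n c' := by
  obtain ⟨C, π⟩ := c
  obtain ⟨C', π'⟩ := c'
  obtain ⟨⟨ha, hs, -⟩, hπ, -⟩ := hc
  obtain ⟨hC, hb, hbπ, hsπ⟩ := h
  have hante : ∀ A ∈ C'.ante, A ∈ C.ante := fun A hA => Multiset.mem_of_le ha hA
  have hsucc : ∀ A ∈ C'.succ, A ∈ C.succ := fun A hA => Multiset.mem_of_le hs hA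
  obtain ⟨V, hVn, hV⟩ := hb.ante
  refine ⟨⟨fun A hA => hC.shallow A (hsucc A hA), ?_, .inl fun A hA hE => ?_⟩,
    ⟨⟨V, hVn, fun A hA => hV A (hante A hA)⟩, fun A hA => hb.succ A (hsucc A hA)⟩, ?_, ?_⟩
  · obtain ⟨Φ, hΦ⟩ := Multiset.le_iff_exists_add.1 hs
    have := hC.linear
    simp only [Clause.succVars] at this ⊢
    rw [show C.succ = C'.succ + Φ from hΦ, Multiset.add_bind, Multiset.nodup_add] at this
    exact this.1
  · obtain ⟨S, -, t, rfl, -⟩ := hV A (hante A hA)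
    obtain ⟨_, _, h⟩ := hE
    cases h
  · cases π <;> cases π' <;> first | trivial | exact fun d hd => hbπ d (hπ hd)
  · cases π <;> cases π' <;> first | trivial | exact fun d hd => hsπ d (hπ hd)

theorem eq_or_properSub_of_condensations {c c' : CClause L}
    (h : Relation.ReflTransGen (fun c c' => IsCondensationOf c' c) c c') :
    c' = c ∨ c'.cl.ProperSub c.cl ∧ c'.con.Sub c.con := by
  induction h with
  | refl => exact .inl rfl
  | tail _ hstep ih =>
    obtain rfl | ih := ih
    · exact .inr ⟨hstep.1, hstep.2.1⟩
    · exact .inr ⟨hstep.1.trans ih.1, hstep.2.1.trans ih.2⟩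

/-- Every clause can be condensed until no condensation applies any more. -/
theorem exists_condensed (c : CClause L) :
    ∃ c', Relation.ReflTransGen (fun c c' => IsCondensationOf c' c) c c' ∧
      ∀ c'', ¬ IsCondensationOf c'' c' := by
  induction hk : c.cl.literals.card using Nat.strong_induction_on generalizing c with
  | _ k ih =>
    by_cases hc : ∃ c₁, IsCondensationOf c₁ c
    · obtain ⟨c₁, hc₁⟩ := hc
      obtain ⟨c', h1, h2⟩ := ih _ (hk ▸ hc₁.1.card_literals_lt) c₁ rfl
      exact ⟨c', .head hc₁ h1, h2⟩
    · exact ⟨c, .refl, not_exists.1 hc⟩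

/-- A ground clause of a clause is entailed by a smaller ground clause of its condensation. -/
theorem redundant_or_ground_subset {lt : Atom L Empty → Atom L Empty → Prop} {c c' : CClause L}
    (h : Relation.ReflTransGen (fun c c' => IsCondensationOf c' c) c c') {N : Set (CClause L)}
    (hN : ground c' ⊆ groundSet N) : Redundant lt c N ∨ ground c ⊆ groundSet N := by
  obtain rfl | ⟨hcl, hcon⟩ := eq_or_properSub_of_condensations h
  · exact .inr hN
  left
  rintro _ ⟨δ, hδ, rfl⟩
  have hsub := hcl.subst δ
  refine ⟨{c'.cl.subst δ}, Set.finite_singleton _, ?_, fun I hI => ?_⟩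
  · rintro _ rfl
    exact ⟨hN ⟨δ, hcon.isSolution hδ, rfl⟩, hsub.clauseLT⟩
  · obtain ⟨A, hA, hAI⟩ | ⟨A, hA, hAI⟩ := hI _ rfl
    · exact .inl ⟨A, Multiset.mem_of_le hsub.2.1 hA, hAI⟩
    · exact .inr ⟨A, Multiset.mem_of_le hsub.1 hA, hAI⟩

end Condensation

/-! ### Saturation -/

section Saturation

variable {L : FirstOrder.Language.{u, v}}

theorem Inferred.boundedResult {lt : Atom L Empty → Atom L Empty → Prop}
    (hlt : AdmissibleOrder lt) {F : Set (Σ n, L.Functions n)} {R : Set (L.Relations 1)} {n : ℕ}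
    (hFn : ∀ p ∈ F, p.1 ≤ n) (hn : 1 ≤ n) {N : Set (CClause L)}
    (hN : ∀ c ∈ N, BoundedInput F R n c) {r : CClause L} (h : Inferred lt N r) :
    BoundedResult F R n r := by
  obtain ⟨c₁, h₁, c₂, h₂, h⟩ | ⟨c, hc, h⟩ := h
  · exact (hN c₁ h₁).resolution hlt hFn hn (hN c₂ h₂) h
  · exact (hN c hc).factoring hFn hn h

/-- As long as the set is not saturated, some fully condensed conclusion has a new set of ground
clauses, of which there are only finitely many. -/
theorem exists_saturation {lt : Atom L Empty → Atom L Empty → Prop}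
    (hlt : AdmissibleOrder lt) {F : Set (Σ n, L.Functions n)} (hF : F.Finite)
    {R : Set (L.Relations 1)} (hR : R.Finite) {n : ℕ}
    (hFn : ∀ p ∈ F, p.1 ≤ n) (hn : 1 ≤ n) (N : Set (CClause L)) (hNf : N.Finite)
    (hN : ∀ c ∈ N, BoundedInput F R n c) :
    ∃ N', Relation.ReflTransGen (SaturationStep lt) N N' ∧ N'.Finite ∧
      (∀ c ∈ N', BoundedInput F R n c) ∧ Saturated lt N' := by
  let 𝒢 : Set (Set (Clause L Empty)) := ground '' {c : CClause L | IsMSL c.cl ∧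
    BoundedClause F R n c.cl ∧ BoundedConstraint F n c.con ∧ c.con.Solved ∧
      ∀ c', ¬ IsCondensationOf c' c}
  have h𝒢 : 𝒢.Finite := finite_ground hF hR n
  induction hk : (𝒢 \ ground '' N).ncard using Nat.strong_induction_on generalizing N with
  | _ k ih =>
  by_cases hsat : Saturated lt N
  · exact ⟨N, .refl, hNf, hN, hsat⟩
  simp only [Saturated, not_forall] at hsat
  obtain ⟨r, hr, hnot⟩ := hsat
  obtain ⟨r', hrr', hr'⟩ := exists_condensed r
  have hbr : BoundedResult F R n r' := by
    have hbr := hr.boundedResult hlt hFn hn hN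
    clear hr' hnot
    induction hrr' with
    | refl => exact hbr
    | tail _ hstep ih => exact ih.condensation hstep
  have hnew : ¬ ground r' ⊆ groundSet N := fun h => hnot (redundant_or_ground_subset hrr' h)
  have hlt' : (𝒢 \ ground '' insert r' N).ncard < k := by
    rw [← hk]
    refine Set.ncard_lt_ncard ⟨?_, fun hsub => ?_⟩ (h𝒢.subset Set.sdiff_subset)
    · exact Set.sdiff_subset_sdiff_right (Set.image_mono (Set.subset_insert _ _))
    · have hmem : ground r' ∈ 𝒢 \ ground '' N := by
        refine ⟨⟨r', ⟨hbr.1, hbr.2.1, hbr.2.2.1, hbr.2.2.2, hr'⟩, rfl⟩, ?_⟩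
        rintro ⟨c, hc, heq⟩
        exact hnew fun D hD => ⟨c, hc, heq ▸ hD⟩
      exact (hsub hmem).2 ⟨r', Set.mem_insert _ _, rfl⟩
  obtain ⟨N', h1, h2⟩ := ih _ hlt' (insert r' N) (hNf.insert r') (by
    rintro c (rfl | hc)
    · exact hbr.boundedInput
    · exact hN c hc) rfl
  exact ⟨N', .head ⟨r, r', hr, hrr', rfl⟩ h1, h2⟩

theorem BoundedInput.mono {F F' : Set (Σ n, L.Functions n)} {R R' : Set (L.Relations 1)} {n n' : ℕ}
    (hF : F ⊆ F') (hR : R ⊆ R') (hn : n ≤ n') {c : CClause L} (h : BoundedInput F R n c) :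
    BoundedInput F' R' n' c := by
  obtain ⟨hC, hπ, hb⟩ := h
  refine ⟨hC, ?_, hb.imp_right fun hb => ⟨?_, fun A hA => ?_⟩⟩
  · generalize c.con = π at hπ
    cases π with
    | bot => trivial
    | conj m =>
      exact fun d hd => ⟨(hπ d hd).1, (hπ d hd).2.1.trans hF, (hπ d hd).2.2.trans hn⟩
  · obtain ⟨V, hVn, hV⟩ := hb.ante
    refine ⟨V, hVn.trans hn, fun A hA => ?_⟩
    obtain ⟨S, hS, t, rfl, ht⟩ := hV A hA
    exact ⟨S, hR hS, t, rfl, ht.imp_right fun ht => ⟨ht.1, ht.2.1.trans hF, ht.2.2.trans hn⟩⟩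
  · obtain ⟨P, hP, t, rfl, ht⟩ := hb.succ A hA
    exact ⟨P, hR hP, t, rfl, ht.trans hF⟩

theorem exists_bound_terms (m : Multiset (L.Term ℕ)) :
    ∃ (F : Set (Σ n, L.Functions n)) (n : ℕ), F.Finite ∧
      ∀ t ∈ m, termFuncs t ⊆ F ∧ termDepth t ≤ n := by
  refine ⟨⋃ t ∈ {t | t ∈ m}, termFuncs t, (m.map termDepth).sup,
    m.finite_toSet.biUnion fun t _ => finite_termFuncs t, fun t ht => ⟨?_, ?_⟩⟩
  · exact Set.subset_biUnion_of_mem (u := fun t => termFuncs t) ht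
  · exact Multiset.le_sup (Multiset.mem_map_of_mem _ ht)

theorem exists_bound_atoms {m : Multiset (Atom L ℕ)} (hm : ∀ A ∈ m, ¬ A.IsEqn) :
    ∃ (F : Set (Σ n, L.Functions n)) (R : Set (L.Relations 1)) (n : ℕ), F.Finite ∧ R.Finite ∧
      ∀ A ∈ m, ∃ S ∈ R, ∃ t, A = .pred S t ∧ termFuncs t ⊆ F ∧ termDepth t ≤ n := by
  induction m using Multiset.induction_on with
  | empty => exact ⟨∅, ∅, 0, Set.finite_empty, Set.finite_empty, by simp⟩
  | cons A m ih =>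
    obtain ⟨F, R, n, hF, hR, h⟩ := ih fun B hB => hm B (Multiset.mem_cons_of_mem hB)
    obtain ⟨S, t⟩ | ⟨s, t⟩ := A
    · refine ⟨F ∪ termFuncs t, insert S R, n + termDepth t, hF.union (finite_termFuncs t),
        hR.insert S, fun B hB => ?_⟩
      obtain rfl | hB := Multiset.mem_cons.1 hB
      · exact ⟨S, Set.mem_insert _ _, t, rfl, Set.subset_union_right, Nat.le_add_left _ _⟩
      · obtain ⟨S', hS', t', rfl, h1, h2⟩ := h B hB
        exact ⟨S', Set.mem_insert_of_mem _ hS', t', rfl, h1.trans Set.subset_union_left,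
          h2.trans (Nat.le_add_right _ _)⟩
    · exact absurd ⟨s, t, rfl⟩ (hm _ (Multiset.mem_cons_self _ _))

theorem IsMSLSDC.exists_boundedInput {c : CClause L} (h : IsMSLSDC c) :
    ∃ (F : Set (Σ n, L.Functions n)) (R : Set (L.Relations 1)) (n : ℕ), F.Finite ∧ R.Finite ∧
      BoundedInput F R n c := by
  classical
  obtain ⟨hC, hπ⟩ := h
  obtain ⟨F₁, n₁, hF₁, hcon⟩ : ∃ (F : Set (Σ n, L.Functions n)) (n : ℕ), F.Finite ∧
      BoundedConstraint F n c.con := by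
    generalize c.con = π at hπ
    cases π with
    | bot => exact ⟨∅, 0, Set.finite_empty, trivial⟩
    | conj m =>
      obtain ⟨F, n, hF, h⟩ := exists_bound_terms (m.map Diseq.rhs)
      exact ⟨F, n, hF, fun d hd => ⟨hπ d hd, h _ (Multiset.mem_map_of_mem _ hd)⟩⟩
  by_cases hE : ∃ A ∈ c.cl.ante, A.IsEqn
  · exact ⟨F₁, ∅, n₁, hF₁, Set.finite_empty, hC, hcon, .inl hE⟩
  obtain ⟨F₂, R, n₂, hF₂, hR, hat⟩ := exists_bound_atoms (m := c.cl.ante + c.cl.succ) (by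
    intro A hA hAE
    obtain hA | hA := Multiset.mem_add.1 hA
    · exact hE ⟨A, hA, hAE⟩
    · obtain ⟨P, t, rfl, -⟩ := hC.shallow A hA
      obtain ⟨_, _, h⟩ := hAE
      cases h)
  have hin : BoundedInput F₁ (∅ : Set (L.Relations 1)) n₁ ⟨⟨0, 0⟩, c.con⟩ := by
    refine ⟨⟨by simp, by simp [Clause.succVars], by simp⟩, hcon, .inr ⟨⟨∅, by simp⟩, by simp⟩⟩
  let V : Finset ℕ := c.cl.vars.toFinset
  have hmono := hin.mono (F' := F₁ ∪ F₂) (R' := R) (n' := n₁ + n₂ + V.card)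
    Set.subset_union_left (Set.empty_subset _) (by omega)
  refine ⟨F₁ ∪ F₂, R, n₁ + n₂ + V.card, hF₁.union hF₂, hR, hC, hmono.2.1, .inr
    ⟨⟨V, by omega, fun A hA => ?_⟩, fun A hA => ?_⟩⟩
  · obtain ⟨S, hS, t, rfl, h1, h2⟩ := hat A (Multiset.mem_add.2 (.inl hA))
    refine ⟨S, hS, t, rfl, .inr ⟨fun x hx => ?_, h1.trans Set.subset_union_right, by omega⟩⟩
    exact Multiset.mem_toFinset.2 (Clause.mem_vars.2 ⟨_, .inl hA, hx⟩)
  · obtain ⟨S, hS, t, rfl, h1, h2⟩ := hat A (Multiset.mem_add.2 (.inr hA))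
    exact ⟨S, hS, t, rfl, h1.trans Set.subset_union_right⟩

theorem exists_boundedInput_of_finite {N : Set (CClause L)} (hNf : N.Finite)
    (hN : ∀ c ∈ N, IsMSLSDC c) :
    ∃ (F : Set (Σ n, L.Functions n)) (R : Set (L.Relations 1)) (n : ℕ), F.Finite ∧ R.Finite ∧
      ∀ c ∈ N, BoundedInput F R n c := by
  induction N, hNf using Set.Finite.induction_on with
  | empty => exact ⟨∅, ∅, 0, Set.finite_empty, Set.finite_empty, by simp⟩
  | @insert c N _ _ ih =>
    obtain ⟨F₁, R₁, n₁, hF₁, hR₁, h₁⟩ := ih fun c hc => hN c (Set.mem_insert_of_mem _ hc)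
    obtain ⟨F₂, R₂, n₂, hF₂, hR₂, h₂⟩ := (hN c (Set.mem_insert _ _)).exists_boundedInput
    refine ⟨F₁ ∪ F₂, R₁ ∪ R₂, n₁ + n₂, hF₁.union hF₂, hR₁.union hR₂, ?_⟩
    rintro d (rfl | hd)
    · exact h₂.mono Set.subset_union_right Set.subset_union_right (by omega)
    · exact (h₁ d hd).mono Set.subset_union_left Set.subset_union_left (by omega)

theorem BoundedInput.isMSLSDC {F : Set (Σ n, L.Functions n)} {R : Set (L.Relations 1)} {n : ℕ}
    {c : CClause L} (h : BoundedInput F R n c) : IsMSLSDC c :=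
  ⟨h.1, h.2.1.isStraightConstraint⟩

/-- Clauses of restricted shape over a finite signature are bounded: the reservoir consists of the
variables of the distinguished shallow term. -/
theorem RestrictedShape.boundedClause {C : Clause L ℕ} (h : RestrictedShape C) (hC : IsMSL C)
    {n : ℕ} (hn : 1 ≤ n) (hFn : ∀ p : Σ n, L.Functions n, p.1 ≤ n) :
    BoundedClause Set.univ Set.univ n C := by
  classical
  obtain ⟨t, Δ, ht, -, -, hante, -⟩ := h
  refine ⟨⟨(termVars t).toFinset, (Multiset.toFinset_card_le _).trans
    (card_termVars_le_of_isShallow (fun p _ => hFn p) hn ht (Set.subset_univ _)),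
    fun A hA => ?_⟩, fun A hA => ?_⟩
  · obtain ⟨S, x, rfl⟩ | ⟨S, rfl⟩ := hante A hA
    · exact ⟨S, trivial, _, rfl, .inl ⟨x, rfl⟩⟩
    · exact ⟨S, trivial, t, rfl, .inr ⟨fun x hx => Multiset.mem_toFinset.2 hx, Set.subset_univ _,
        le_trans ht hn⟩⟩
  · obtain ⟨P, s, rfl, -⟩ := hC.shallow A hA
    exact ⟨P, trivial, s, rfl, Set.subset_univ _⟩

theorem Constraint.boundedConstraint_of_depth_le {π : Constraint L ℕ}
    (h : π.IsStraightConstraint) {n : ℕ} (hn : π.depth ≤ n) :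
    BoundedConstraint Set.univ n π := by
  cases π with
  | bot => trivial
  | conj m =>
    exact fun d hd => ⟨h d hd, Set.subset_univ _,
      (Multiset.le_sup (Multiset.mem_map_of_mem _ hd)).trans hn⟩

end Saturation

end MSLSDC

theorem mainTheorem2 (L : FirstOrder.Language.{u, v})
    (lt : MSLSDC.Atom L Empty → MSLSDC.Atom L Empty → Prop)
    (hlt : MSLSDC.AdmissibleOrder lt) :
    -- finite saturation
    (∀ N : Set (MSLSDC.CClause L), N.Finite → (∀ c ∈ N, MSLSDC.IsMSLSDC c) →
      ∃ N' : Set (MSLSDC.CClause L),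
        Relation.ReflTransGen (MSLSDC.SaturationStep lt) N N' ∧
        N'.Finite ∧ (∀ c ∈ N', MSLSDC.IsMSLSDC c) ∧ MSLSDC.Saturated lt N') ∧
    -- finitely many clauses of restricted shape
    (Finite L.Symbols → ∀ (N : Set (MSLSDC.CClause L)) (d : ℕ),
      (∀ c ∈ N, MSLSDC.IsMSLSDC c ∧ c.con.IsNormal ∧ c.con.depth ≤ d ∧
        MSLSDC.RestrictedShape c.cl) →
      (∀ c ∈ N, ∀ c', ¬ MSLSDC.IsCondensationOf c' c) →
      (∀ c ∈ N, ∀ c' ∈ N, MSLSDC.Variants c c' → c = c') →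
      N.Finite) := by
  constructor
  · intro N hNf hN
    obtain ⟨F, R, n, hF, hR, h⟩ := MSLSDC.exists_boundedInput_of_finite hNf hN
    obtain ⟨a, ha⟩ := MSLSDC.exists_arity_le hF
    obtain ⟨N', h1, h2, h3, h4⟩ := MSLSDC.exists_saturation (n := n + a + 1) hlt hF hR
      (fun p hp => (ha p hp).trans (by omega)) (by omega) N hNf
      fun c hc => (h c hc).mono subset_rfl subset_rfl (by omega)
    exact ⟨N', h1, h2, fun c hc => (h3 c hc).isMSLSDC, h4⟩
  · intro hfin N d hN hcond hvar
    have hfin' : Finite ((Σ l, L.Functions l) ⊕ Σ l, L.Relations l) := hfin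
    have hF : (Set.univ : Set (Σ l, L.Functions l)).Finite :=
      @Set.finite_univ _ (Finite.sum_left (β := Σ l, L.Relations l))
    have hR : (Set.univ : Set (L.Relations 1)).Finite :=
      @Set.finite_univ _ (Finite.of_injective
        (fun S => (.inr ⟨1, S⟩ : (Σ l, L.Functions l) ⊕ Σ l, L.Relations l))
        fun S S' h => by simpa using h)
    obtain ⟨a, ha⟩ := MSLSDC.exists_arity_le hF
    refine Set.Finite.of_finite_image ((MSLSDC.finite_ground hF hR (d + a + 1)).subset ?_)
      fun c hc c' hc' h => hvar c hc c' hc' h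
    rintro _ ⟨c, hc, rfl⟩
    obtain ⟨⟨hC, hπ⟩, hnormal, hdepth, hshape⟩ := hN c hc
    exact ⟨c, ⟨hC, hshape.boundedClause hC (by omega) fun p => (ha p trivial).trans (by omega),
      MSLSDC.Constraint.boundedConstraint_of_depth_le hπ (by omega), hnormal.solved hπ,
      hcond c hc⟩, rfl⟩
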